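/- Let $n\ge 2$ and let $L(x)=x^{(n)}+a_{n-1}x^{(n-1)}+\dots+a_1x'+a_0x$ with $a_i\in\mathbb{C}(t)$ and $'=\frac{d}{dt}$. Assume that $L(x)=0$ is irreducible ($L$ is not a product of two differential operators of positive order over $\mathbb{C}(t)$) and algebraic (all its solutions are algebraic over $\mathbb{C}(t)$). Then $L(x)=0$ is standard if and only if it is rationally projectively equivalent to a linear ordinary differential equation $L_1(y)=0$ of order $n$ over $\mathbb{C}(t)$, again algebraic and irreducible, that has an associated first order differential equation which is a dynamical system. Here the notions are as follows. For linearly independent solutions $x_1,\dots,x_n$ of an algebraic irreducible equation, let $G\subset GL_n(\mathbb{C})$ be the corresponding representation of its differential Galois group over $\mathbb{C}(t)$, and let $\mathbb{C}[X_1,\dots,X_n]^G_\Lambda$ be the space of $G$-invariant forms of degree $\Lambda$. (a) The equation is standard if the map $\mathbb{P}^1(\mathbb{C})\to\mathbb{P}(\mathbb{C}^n/G)=\operatorname{Proj}\mathbb{C}[X_1,\dots,X_n]^G$, $t\mapsto\Pi_{G,\mathbb{P}}(x_1(t):\dots:x_n(t))$, where $\Pi_{G,\mathbb{P}}$ is the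 projection of $\mathbb{P}^{n-1}(\mathbb{C})$ onto the space of projective orbits, is birational onto the closure of its image (the quotient Fano curve); this does not depend on the choice of $x_1,\dots,x_n$. (b) $L(x)=0$ is rationally projectively equivalent to $L_1(y)=0$ if there is a function $f$ with $f'/f\in\mathbb{C}(t)$ such that every solution of $L(x)=0$ is of the form $fy_0$ with $L_1(y_0)=0$. (c) An associated first order differential equation of $L_1(y)=0$ is given by the choice of linearly independent solutions $y_1,\dots,y_n$, with Galois representation $G_1$; of an integer $\Lambda>0$ such that $\mathbb{C}[X_1,\dots,X_n]^{G_1}_\Lambda$ is a homogeneous coordinate system for $\mathbb{P}(\mathbb{C}^n/G_1)$, i.e. its elements define an isomorphism of $\mathbb{P}(\mathbb{C}^n/G_1)$ onto its image in projective space; and of $P_1,\dots,P_n\in\mathbb{C}[X_1,\dots,X_n]^{G_1}_\Lambda$ whose Jacobian matrix $M(\mathbf{X})=(\partial P_i/\partial X_j)$ is invertible at $\mathbf{X}=(y_1,\dots,y_n)$. With $f_i=P_i(y_1,\dots,y_n)\in\mathbb{C}(t)$ the equation is $$\frac{d}{dt}\mathbf{X}=F(t,\mathbf{X}),\qquad F(t,\mathbf{X})=M(\mathbf{X})^{-1}\begin{pmatrix}f_1'\\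 \vdots\\ f_n'\end{pmatrix}.$$ It is a dynamical system (autonomous) if $F(t,\mathbf{X})$ does not depend on $t$. -/

import Mathlib

noncomputable section

namespace SchwarzODE

open Polynomial TensorProduct

/-! ### The differential field `ℂ(t)` and its algebraic closure -/

/-- The field `ℂ(t)` of rational functions. -/
abbrev Ct : Type := RatFunc ℂ

/-- An algebraic closure of `ℂ(t)`: the algebraic functions of `t`. -/
abbrev CtBar : Type := AlgebraicClosure Ct

instance : Algebra.FormallyEtale ℂ[X] Ct :=
  Algebra.FormallyEtale.of_isLocalization (nonZeroDivisors ℂ[X])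

instance : Algebra.FormallyEtale Ct CtBar :=
  Algebra.FormallyEtale.of_isSeparable Ct CtBar

instance : Algebra.FormallyEtale ℂ[X] CtBar :=
  Algebra.FormallyEtale.comp ℂ[X] Ct CtBar

/-- The derivation `d/dt` on a field `K` that is formally étale over `ℂ[t]`
(used for `K = ℂ(t)` and for `K` the algebraic closure of `ℂ(t)`): the unique `ℂ`-derivation of `K`
that extends the derivative of polynomials. -/
def ddt (K : Type) [Field K] [Algebra ℂ K] [Algebra ℂ[X] K] [IsScalarTower ℂ ℂ[X] K]
    [Algebra.FormallyEtale ℂ[X] K] : Derivation ℂ K K :=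
  ((((IsScalarTower.toAlgHom ℂ[X] ℂ[X] K).toLinearMap.compDer
      (Polynomial.derivative' : Derivation ℂ ℂ[X] ℂ[X])).liftKaehlerDifferential.liftBaseChange K) ∘ₗ
    (KaehlerDifferential.tensorKaehlerEquivOfFormallyEtale ℂ ℂ[X] K).symm.toLinearMap).compDer
      (KaehlerDifferential.D ℂ K)

/-- `d/dt` extends the derivative of polynomials; in particular `dt/dt = 1`. -/
theorem ddt_algebraMap (K : Type) [Field K] [Algebra ℂ K] [Algebra ℂ[X] K]
    [IsScalarTower ℂ ℂ[X] K] [Algebra.FormallyEtale ℂ[X] K] (p : ℂ[X]) :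
    ddt K (algebraMap ℂ[X] K p) = algebraMap ℂ[X] K (Polynomial.derivative p) := by
  have h := KaehlerDifferential.tensorKaehlerEquivOfFormallyEtale_symm_D_algebraMap ℂ ℂ[X] K p
  simp [ddt, h]

/-- The derivation of the algebraic closure extends that of `ℂ(t)`. -/
theorem ddt_alg_algebraMap (u : Ct) :
    ddt CtBar (algebraMap Ct CtBar u) = algebraMap Ct CtBar (ddt Ct u) := by
  obtain ⟨p, q, hq, rfl⟩ := IsFractionRing.div_surjective (A := ℂ[X]) u
  have hq0 : q ≠ 0 := nonZeroDivisors.ne_zero hq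
  have e (r : ℂ[X]) : algebraMap Ct CtBar (algebraMap ℂ[X] Ct r) = algebraMap ℂ[X] CtBar r :=
    (IsScalarTower.algebraMap_apply ℂ[X] Ct CtBar r).symm
  simp [Derivation.leibniz_div, ddt_algebraMap, e, smul_eq_mul]

/-! ### Linear ordinary differential equations over `ℂ(t)` -/

/-- A monic linear differential operator
`L = (d/dt)^n + a_{n-1} (d/dt)^{n-1} + ... + a_0` of order `n` with `a_i ∈ ℂ(t)`. -/
structure LinODE (n : ℕ) where
  coeff : Fin n → Ct

namespace LinODE

variable {n : ℕ}

/-- `L(x)`, for an algebraic function `x`. -/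
def app (L : LinODE n) (x : CtBar) : CtBar :=
  (ddt CtBar)^[n] x + ∑ i : Fin n, algebraMap Ct CtBar (L.coeff i) * (ddt CtBar)^[i] x

/-- `x_1, ..., x_n` is a full system of solutions of `L(x) = 0`: it consists of `n = ord L`
solutions that are linearly independent over the field of constants `ℂ`. -/
def IsFullSystem (L : LinODE n) (x : Fin n → CtBar) : Prop :=
  (∀ j, L.app (x j) = 0) ∧ LinearIndependent ℂ x

/-- `L(x) = 0` is algebraic: all its solutions are algebraic over `ℂ(t)`. The solutions
form a `ℂ`-vector space of dimension `n = ord L`, so this says that there is a full system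
of solutions among the algebraic functions. -/
def IsAlgebraic (L : LinODE n) : Prop :=
  ∃ x : Fin n → CtBar, L.IsFullSystem x

/-- `L(x) = 0` is irreducible: `L` has positive order and is not a product (composition) of two
differential operators of positive order with coefficients in `ℂ(t)`. (The factors may be taken
monic, and an operator is determined by its action on algebraic functions.) -/
def IsIrreducible (L : LinODE n) : Prop :=
  0 < n ∧ ∀ (p q : ℕ) (A : LinODE p) (B : LinODE q), 0 < p → 0 < q →
    ¬ ∀ u : CtBar, L.app u = A.app (B.app u)

/-- `L₁(y) = 0` is rationally projectively equivalent to `L(x) = 0` (for algebraic equations of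
the same order): for some function `f` with `f'/f ∈ ℂ(t)`, every solution of `L₁(y) = 0` is of the
form `f x` with `L(x) = 0`. As a quotient of nonzero solutions, `f` is an algebraic function. -/
def IsRatProjEquiv (L₁ L : LinODE n) : Prop :=
  ∃ f : CtBar, f ≠ 0 ∧ (∃ r : Ct, f⁻¹ * ddt CtBar f = algebraMap Ct CtBar r) ∧
    ∀ y : CtBar, L₁.app y = 0 → ∃ x : CtBar, L.app x = 0 ∧ y = f * x

end LinODE

/-! ### The differential Galois group and its invariants -/

variable {n : ℕ}

/-- The representation `G ⊆ GL_n(ℂ)` of the differential Galois group given by a full system of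
solutions `x = (x_1, ..., x_n)`: the matrices `g` for which a differential automorphism `σ` over
`ℂ(t)` sends `x_j` to `∑_l x_l g_{lj}`. The Picard-Vessiot extension generated by the
`x_j` is normal over `ℂ(t)`, so its differential automorphisms are the restrictions of those of the
algebraic closure. -/
def galoisRep (x : Fin n → CtBar) : Subgroup (GL (Fin n) ℂ) where
  carrier := {g | ∃ σ : CtBar ≃ₐ[Ct] CtBar, (∀ u, σ (ddt CtBar u) = ddt CtBar (σ u)) ∧
    ∀ j, σ (x j) = ∑ l, x l * algebraMap ℂ CtBar ((g : Matrix (Fin n) (Fin n) ℂ) l j)}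
  one_mem' := ⟨AlgEquiv.refl, fun _ => rfl, fun j => by simp [Matrix.one_apply]⟩
  mul_mem' := by
    rintro g h ⟨σ, hσ, hg⟩ ⟨τ, hτ, hh⟩
    refine ⟨τ.trans σ, fun u => by simp [hσ, hτ], fun j => ?_⟩
    have e (c : ℂ) : σ (algebraMap ℂ CtBar c) = algebraMap ℂ CtBar c :=
      (σ.restrictScalars ℂ).commutes c
    simp only [AlgEquiv.trans_apply, hh, map_sum, map_mul, e, hg, Units.val_mul, Matrix.mul_apply,
      Finset.mul_sum, Finset.sum_mul]
    rw [Finset.sum_comm]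
    simp only [mul_assoc]
  inv_mem' := by
    rintro g ⟨σ, hσ, hg⟩
    have e (c : ℂ) : σ (algebraMap ℂ CtBar c) = algebraMap ℂ CtBar c :=
      (σ.restrictScalars ℂ).commutes c
    refine ⟨σ.symm, fun u => ?_, fun j => ?_⟩
    · apply σ.injective
      rw [hσ]
      simp
    · apply σ.injective
      have hmul : (g : Matrix (Fin n) (Fin n) ℂ) * ((g⁻¹ : GL (Fin n) ℂ) : Matrix _ _ ℂ) = 1 := by
        rw [← Units.val_mul, mul_inv_cancel, Units.val_one]
      simp only [AlgEquiv.apply_symm_apply, map_sum, map_mul, e, hg, Finset.sum_mul, mul_assoc]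
      rw [Finset.sum_comm]
      simp only [← Finset.mul_sum, ← map_mul, ← map_sum, ← Matrix.mul_apply, hmul]
      simp [Matrix.one_apply]

/-- The action of a matrix `g` on `ℂ[X_1, ..., X_n]` by `X_j ↦ ∑_l X_l g_{lj}`. -/
def substitute (g : GL (Fin n) ℂ) : MvPolynomial (Fin n) ℂ →ₐ[ℂ] MvPolynomial (Fin n) ℂ :=
  MvPolynomial.aeval fun j => ∑ l, (g : Matrix (Fin n) (Fin n) ℂ) l j • MvPolynomial.X l

/-- The ring of invariants `ℂ[X_1, ..., X_n]^G`. -/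
def invariants (G : Subgroup (GL (Fin n) ℂ)) : Subalgebra ℂ (MvPolynomial (Fin n) ℂ) :=
  ⨅ g ∈ G, AlgHom.equalizer (substitute g) (AlgHom.id ℂ _)

/-- `ℂ[X_1, ..., X_n]^G_k`: the invariants of `G` that are homogeneous of degree `k`. -/
def invariantForms (G : Subgroup (GL (Fin n) ℂ)) (k : ℕ) :
    Submodule ℂ (MvPolynomial (Fin n) ℂ) :=
  Subalgebra.toSubmodule (invariants G) ⊓ MvPolynomial.homogeneousSubmodule (Fin n) ℂ k

/-! ### Standard equations -/

/-- The function field of the quotient Fano curve `C ⊆ ℙ(ℂⁿ/G)`, pulled back to `ℂ(t)` along the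
parametrization `Π_{G,ℙ} ∘ [X] : ℙ¹ → C`, `t ↦ Π_{G,ℙ}(x_1(t) : ... : x_n(t))`. A rational function
on `C` is a quotient `A/B` of two forms of the same degree in the homogeneous
coordinate ring `ℂ[X_1, ..., X_n]^G` of `ℙ(ℂⁿ/G)`, with `B` not identically zero on `C`, and its
pull-back is `A(x_1, ..., x_n)/B(x_1, ..., x_n) ∈ ℂ(t)`. -/
def quotientFanoField (x : Fin n → CtBar) : IntermediateField ℂ Ct where
  carrier := {u | ∃ (k : ℕ) (A B : MvPolynomial (Fin n) ℂ),
    A ∈ invariantForms (galoisRep x) k ∧ B ∈ invariantForms (galoisRep x) k ∧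
    MvPolynomial.aeval x B ≠ 0 ∧
    algebraMap Ct CtBar u = MvPolynomial.aeval x A / MvPolynomial.aeval x B}
  algebraMap_mem' c := ⟨0, MvPolynomial.C c, 1,
    ⟨(invariants _).algebraMap_mem c, MvPolynomial.isHomogeneous_C _ _⟩,
    ⟨(invariants _).one_mem, MvPolynomial.isHomogeneous_one _ _⟩, by simp, by
      simpa using (IsScalarTower.algebraMap_apply ℂ Ct CtBar c).symm⟩
  add_mem' := by
    rintro u v ⟨k, A, B, hA, hB, hB0, hu⟩ ⟨l, A', B', hA', hB', hB0', hv⟩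
    refine ⟨k + l, A * B' + B * A', B * B',
      ⟨(invariants _).add_mem ((invariants _).mul_mem hA.1 hB'.1)
        ((invariants _).mul_mem hB.1 hA'.1),
        MvPolynomial.IsHomogeneous.add (MvPolynomial.IsHomogeneous.mul hA.2 hB'.2)
          (MvPolynomial.IsHomogeneous.mul hB.2 hA'.2)⟩,
      ⟨(invariants _).mul_mem hB.1 hB'.1, MvPolynomial.IsHomogeneous.mul hB.2 hB'.2⟩, ?_, ?_⟩
    · rw [map_mul]
      exact mul_ne_zero hB0 hB0'
    · rw [map_add, hu, hv, div_add_div _ _ hB0 hB0']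
      simp
  mul_mem' := by
    rintro u v ⟨k, A, B, hA, hB, hB0, hu⟩ ⟨l, A', B', hA', hB', hB0', hv⟩
    refine ⟨k + l, A * A', B * B',
      ⟨(invariants _).mul_mem hA.1 hA'.1, MvPolynomial.IsHomogeneous.mul hA.2 hA'.2⟩,
      ⟨(invariants _).mul_mem hB.1 hB'.1, MvPolynomial.IsHomogeneous.mul hB.2 hB'.2⟩, ?_, ?_⟩
    · rw [map_mul]
      exact mul_ne_zero hB0 hB0'
    · rw [map_mul, hu, hv, div_mul_div_comm]
      simp
  inv_mem' := by
    rintro u ⟨k, A, B, hA, hB, hB0, hu⟩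
    by_cases hA0 : MvPolynomial.aeval x A = 0
    · have : u = 0 := by
        rw [hA0, zero_div] at hu
        exact (map_eq_zero _).1 hu
      exact ⟨k, A, B, hA, hB, hB0, by simp [this, hA0]⟩
    · exact ⟨k, B, A, hB, hA, hA0, by rw [map_inv₀, hu, inv_div]⟩

/-- The Schwarz map `(x_1 : ... : x_n)` is minimal: `Π_{G,ℙ} ∘ [X]` is birational onto the quotient
Fano curve, i.e. the pull-back of rational functions identifies the function field of the
quotient Fano curve with `ℂ(t)`. -/
def IsMinimalSchwarzMap (x : Fin n → CtBar) : Prop :=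
  quotientFanoField x = ⊤

/-- `L(x) = 0` is standard: its Schwarz map associated to a full system of solutions is minimal.
(Two full systems differ by a matrix in `GL_n(ℂ)`, which conjugates `G` accordingly, so
this does not depend on the full system.) -/
def LinODE.IsStandard (L : LinODE n) : Prop :=
  ∃ x : Fin n → CtBar, L.IsFullSystem x ∧ IsMinimalSchwarzMap x

/-! ### Associated first order differential equations -/

/-- The forms in `ℂ[X]^G_Λ`, for `Λ > 0`, are a homogeneous coordinate system for `ℙ(ℂⁿ/G)`: they
define an isomorphism of `ℙ(ℂⁿ/G) = Proj ℂ[X]^G` onto its image in projective space. That is, they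
have no common zero, and on the chart where `P ∈ ℂ[X]^G_Λ` does not vanish every regular
function `A / P^k` on `ℙ(ℂⁿ/G)` is a polynomial in the affine coordinates `Q / P`, `Q ∈ ℂ[X]^G_Λ`
(so the map to projective space is a closed immersion). -/
def IsCoordinateDegree (G : Subgroup (GL (Fin n) ℂ)) (Λ : ℕ) : Prop :=
  0 < Λ ∧
  (∀ v : Fin n → ℂ, v ≠ 0 → ∃ P ∈ invariantForms G Λ, MvPolynomial.eval v P ≠ 0) ∧
  ∀ P ∈ invariantForms G Λ, ∀ (k : ℕ), ∀ A ∈ invariantForms G (k * Λ),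
    ∃ m : ℕ, A * P ^ m ∈ invariantForms G Λ ^ (k + m)

/-- The Jacobian matrix `M = (∂P_i/∂X_j)`. -/
def jacobian (P : Fin n → MvPolynomial (Fin n) ℂ) :
    Matrix (Fin n) (Fin n) (MvPolynomial (Fin n) ℂ) :=
  Matrix.of fun i j => MvPolynomial.pderiv j (P i)

/-- `(P, f)` defines a first order differential equation `dX/dt = F(t, X)` associated to
`L(x) = 0`, given the full system of solutions `x` and the degree `Λ`: the `P_i` are `n` forms in
`ℂ[X]^G_Λ`, where the latter is a homogeneous coordinate system for `ℙ(ℂⁿ/G)`,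
`f_i = P_i(x_1, ..., x_n)`, and the Jacobian matrix `M(X)` is invertible at `X = (x_1, ..., x_n)`
(so that `(x_1, ..., x_n)` is a solution of `dX/dt = F(t, X)`). -/
structure IsAssociatedData (L : LinODE n) (x : Fin n → CtBar) (Λ : ℕ)
    (P : Fin n → MvPolynomial (Fin n) ℂ) (f : Fin n → Ct) : Prop where
  fullSystem : L.IsFullSystem x
  coordinateDegree : IsCoordinateDegree (galoisRep x) Λ
  mem_invariantForms : ∀ i, P i ∈ invariantForms (galoisRep x) Λ
  det_jacobian_ne_zero : ((jacobian P).map (MvPolynomial.aeval x)).det ≠ 0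
  eval_eq : ∀ i, algebraMap Ct CtBar (f i) = MvPolynomial.aeval x (P i)

/-- The right-hand side `F(t, v) = M(v)⁻¹ (df_1/dt, ..., df_n/dt)` at a point `v ∈ ℂⁿ` where `M(v)`
is invertible, as a vector of rational functions of `t`. -/
def associatedField (P : Fin n → MvPolynomial (Fin n) ℂ) (f : Fin n → Ct) (v : Fin n → ℂ) :
    Fin n → Ct :=
  Matrix.mulVec ((((jacobian P).map (MvPolynomial.eval v))⁻¹).map (algebraMap ℂ Ct))
    fun i => ddt Ct (f i)

/-- `dX/dt = F(t, X)` is a dynamical system: at every point `v` where `M(v)` is invertible,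
`F(t, v)` does not depend on `t`. -/
def IsDynamicalSystem (P : Fin n → MvPolynomial (Fin n) ℂ) (f : Fin n → Ct) : Prop :=
  ∀ v : Fin n → ℂ, ((jacobian P).map (MvPolynomial.eval v)).det ≠ 0 →
    ∀ i, ∃ c : ℂ, associatedField P f v i = algebraMap ℂ Ct c

/-- The algebraic irreducible equation `L(x) = 0` has an associated first order differential
equation that is a dynamical system. -/
def LinODE.HasAssociatedDynamicalSystem (L : LinODE n) : Prop :=
  L.IsAlgebraic ∧ L.IsIrreducible ∧
    ∃ (x : Fin n → CtBar) (Λ : ℕ) (P : Fin n → MvPolynomial (Fin n) ℂ) (f : Fin n → Ct),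
      IsAssociatedData L x Λ P f ∧ IsDynamicalSystem P f

end SchwarzODE

end

noncomputable section

namespace SchwarzODE

open Polynomial TensorProduct

/-! Both conditions say that `t = A(y)/B(y)` for two invariant forms of equal degree. Standardness
says so directly: the function field of the quotient Fano curve lies in `ℂ(t)`, and equals it
exactly when it contains `t`. An associated equation is autonomous exactly when all `f_i'` are
constant, since `M(v)` does not involve `t`; that is, when every `f_i = P_i(y)` is affine in `t`.

From standard to autonomous: if `t = A(x)/B(x)` with forms of degree `k`, take `f` with `f^k = B(x)`
and `y = x/f`. Then `B(y) = 1` and `A(y) = t`, and `f'/f` is rational because `f^k` is. The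
conjugates of `f` are multiples by `k`-th roots of unity, so `A` and `B` stay invariant for `y`. It
remains to find `n` invariant forms of one degree with affine values and independent gradients at
`y` (`exists_forms_det_jacobian_ne_zero`). If the gradients never span, a linear functional on them
gives a derivation at `y` that kills every affine-valued invariant form. It then kills all invariant
forms of the relevant degrees, because their values are rational in `t = A(y)` and `1 = B(y)`. It
also kills each `X_j`, which is algebraic over these forms with a relation that stays separable at
`y`. So the functional is zero. Finiteness of the Galois group makes all sufficiently divisible
degrees coordinate degrees (`exists_isCoordinateDegree`).

From autonomous to standard: the affine values `a_i + b_i t` are not all proportional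
(`exists_not_proportional`), since otherwise Euler's relation forces all `y_j` to satisfy one first
order equation `y' = s y`, against independence. Two of them therefore give `t` as a quotient of
invariant forms. Passing from `y` back to `x = f y` costs only a multiple of the degree, as
conjugates of `f` differ by roots of unity of bounded order (`exists_pow_eq_one_of_logDeriv`). -/

variable {n : ℕ}

/-! ### Derivations and constants -/

/-- Two derivations of the algebraic closure that agree on `ℂ(t)` are equal. -/
theorem derivation_ext_of_algebraMap {D₁ D₂ : Derivation ℂ CtBar CtBar}
    (h : ∀ u : Ct, D₁ (algebraMap Ct CtBar u) = D₂ (algebraMap Ct CtBar u)) : D₁ = D₂ := by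
  -- The difference vanishes on `ℂ(t)`, hence is `ℂ(t)`-linear; applied to the separable equation
  -- `p(u) = 0` it gives `p'(u) E(u) = 0` with `p'(u) ≠ 0`.
  let E : Derivation Ct CtBar CtBar := Derivation.mk'
    { toFun := fun u => D₁ u - D₂ u
      map_add' := fun u v => by simp only [map_add]; ring
      map_smul' := fun c u => by
        simp only [Algebra.smul_def c, Derivation.leibniz, h, smul_eq_mul, RingHom.id_apply]
        ring }
    (fun u v => by
      simp only [LinearMap.coe_mk, AddHom.coe_mk, Derivation.leibniz, smul_eq_mul]
      ring)
  ext u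
  have hu : IsIntegral Ct u := Algebra.IsIntegral.isIntegral u
  have h1 := E.map_aeval (minpoly Ct u) u
  rw [minpoly.aeval, Derivation.map_zero, smul_eq_mul] at h1
  have hsep : (minpoly Ct u).Separable := (minpoly.irreducible hu).separable
  rcases mul_eq_zero.1 h1.symm with h2 | h2
  · exact absurd h2 (hsep.aeval_derivative_ne_zero (minpoly.aeval _ _))
  · exact sub_eq_zero.1 h2

/-- Automorphisms of the algebraic closure over `ℂ(t)` commute with `d/dt`. -/
theorem algEquiv_ddt (σ : CtBar ≃ₐ[Ct] CtBar) (u : CtBar) :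
    σ (ddt CtBar u) = ddt CtBar (σ u) := by
  let τ : CtBar ≃ₐ[ℂ] CtBar := σ.restrictScalars ℂ
  -- The conjugate of `d/dt` by `σ` is again a derivation that extends the one on `ℂ(t)`, so it is
  -- `d/dt`.
  let E : Derivation ℂ CtBar CtBar := Derivation.mk'
    (τ.symm.toLinearMap ∘ₗ (ddt CtBar).toLinearMap ∘ₗ τ.toLinearMap)
    (fun u v => by
      simp [Derivation.leibniz, smul_eq_mul])
  have hE : E = ddt CtBar := derivation_ext_of_algebraMap fun u => by
    have h1 : τ (algebraMap Ct CtBar u) = algebraMap Ct CtBar u := σ.commutes u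
    have h2 : τ.symm (algebraMap Ct CtBar (ddt Ct u)) = algebraMap Ct CtBar (ddt Ct u) :=
      σ.symm.commutes _
    change τ.symm (ddt CtBar (τ (algebraMap Ct CtBar u))) = _
    rw [h1, ddt_alg_algebraMap, h2]
  have h3 : τ.symm (ddt CtBar (τ u)) = ddt CtBar u := congrArg (fun d => d u) hE
  calc σ (ddt CtBar u) = τ (τ.symm (ddt CtBar (τ u))) := by rw [h3]; rfl
    _ = ddt CtBar (σ u) := by rw [AlgEquiv.apply_symm_apply]; rfl

/-- The constants of `ℂ(t)` are the complex numbers. -/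
theorem exists_eq_algebraMap_of_ddt_eq_zero {u : Ct} (hu : ddt Ct u = 0) :
    ∃ c : ℂ, u = algebraMap ℂ Ct c := by
  have hq0 : algebraMap ℂ[X] Ct u.denom ≠ 0 := by
    simpa using u.denom_ne_zero
  have h1 : u * algebraMap ℂ[X] Ct u.denom = algebraMap ℂ[X] Ct u.num := by
    conv_lhs => rw [← u.num_div_denom]
    rw [u.num_div_denom]
    exact (eq_div_iff hq0).1 u.num_div_denom.symm
  have h2 := congrArg (ddt Ct) h1
  rw [Derivation.leibniz, hu, smul_zero, add_zero, ddt_algebraMap, ddt_algebraMap, smul_eq_mul] at h2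
  have h3 : u.num * derivative u.denom = u.denom * derivative u.num := by
    apply RatFunc.algebraMap_injective ℂ
    rw [map_mul, map_mul, ← h2, ← h1]; ring
  -- The denominator divides its own derivative, which has smaller degree, so it is constant.
  have h4 : u.denom ∣ derivative u.denom :=
    (RatFunc.isCoprime_num_denom u).symm.dvd_of_dvd_mul_left ⟨_, h3⟩
  have h5 : derivative u.denom = 0 := by
    by_contra h
    exact absurd (Polynomial.degree_le_of_dvd h4 h)
      (not_le.2 (Polynomial.degree_derivative_lt u.denom_ne_zero))
  have h6 : u.denom = 1 := by
    exact (RatFunc.monic_denom u).natDegree_eq_zero.1 (Polynomial.derivative_eq_zero.1 h5)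
  rw [h6] at h3 h1
  obtain ⟨c, hc⟩ := Polynomial.natDegree_eq_zero.1
    (by simpa using h3.symm : u.num.natDegree = 0)
  refine ⟨c, ?_⟩
  rw [map_one, mul_one] at h1
  rw [h1, ← hc]
  rfl

/-- The constants of the algebraic closure of `ℂ(t)` are the complex numbers. -/
theorem exists_eq_algebraMap_of_ddt_alg_eq_zero {u : CtBar} (hu : ddt CtBar u = 0) :
    ∃ c : ℂ, u = algebraMap ℂ CtBar c := by
  have hint : IsIntegral Ct u := Algebra.IsIntegral.isIntegral u
  set p := minpoly Ct u with hp
  have hm : p.Monic := minpoly.monic hint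
  have h1 : ∑ i ∈ Finset.range (p.natDegree + 1), algebraMap Ct CtBar (p.coeff i) * u ^ i = 0 := by
    simpa only [Polynomial.aeval_eq_sum_range, Algebra.smul_def] using minpoly.aeval Ct u
  have h2 := congrArg (ddt CtBar) h1
  simp only [map_sum, Derivation.leibniz, Derivation.leibniz_pow, hu, ddt_alg_algebraMap, map_zero,
    smul_zero, mul_zero, zero_add, smul_eq_mul] at h2
  -- As `u' = 0`, differentiating the minimal equation differentiates only its coefficients. The
  -- leading one is 1, so the result has lower degree and must vanish identically.
  have h3 : ∀ i, ddt Ct (p.coeff i) = 0 := by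
    set q : Ct[X] := ∑ i ∈ Finset.range (p.natDegree), monomial i (ddt Ct (p.coeff i)) with hq
    have hq0 : q = 0 := by
      by_contra hne
      have hev : aeval u q = 0 := by
        rw [Finset.sum_range_succ, hm.coeff_natDegree] at h2
        rw [Derivation.map_one_eq_zero, map_zero, mul_zero, add_zero] at h2
        rw [hq, map_sum, ← h2]
        exact Finset.sum_congr rfl fun i _ => by rw [aeval_monomial, mul_comm]
      have hlt : q.degree < p.degree := by
        rw [Polynomial.degree_eq_natDegree hm.ne_zero]
        refine (Polynomial.degree_sum_le _ _).trans_lt ((Finset.sup_lt_iff (WithBot.bot_lt_coe _)).2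
          fun i hi => (Polynomial.degree_monomial_le _ _).trans_lt ?_)
        exact_mod_cast Finset.mem_range.1 hi
      exact absurd (minpoly.degree_le_of_ne_zero Ct u hne hev) (not_le.2 hlt)
    intro i
    rcases lt_trichotomy i p.natDegree with hi | rfl | hi
    · have := congrArg (fun r : Ct[X] => r.coeff i) hq0
      simpa [hq, Polynomial.coeff_monomial, hi] using this
    · rw [hm.coeff_natDegree, Derivation.map_one_eq_zero]
    · rw [Polynomial.coeff_eq_zero_of_natDegree_lt hi, map_zero]
  have h4 : p ∈ Polynomial.lifts (algebraMap ℂ Ct) := by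
    rw [Polynomial.lifts_iff_coeff_lifts]
    intro i
    obtain ⟨c, hc⟩ := exists_eq_algebraMap_of_ddt_eq_zero (h3 i)
    exact ⟨c, hc.symm⟩
  obtain ⟨q, hq, -, hqm⟩ := Polynomial.lifts_and_degree_eq_and_monic h4 hm
  have hqu : aeval u q = 0 := by
    rw [← Polynomial.aeval_map_algebraMap Ct, hq, minpoly.aeval]
  have hi : IsIntegral ℂ u := ⟨q, hqm, hqu⟩
  have hbot : IntermediateField.adjoin ℂ {u} = ⊥ := by
    have := IntermediateField.isAlgebraic_adjoin_simple hi
    exact IntermediateField.eq_bot_of_isAlgClosed_of_isAlgebraic _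
  obtain ⟨c, hc⟩ := IntermediateField.mem_bot.1
    (hbot ▸ IntermediateField.mem_adjoin_simple_self ℂ u)
  exact ⟨c, hc.symm⟩

theorem iterate_ddt_add (k : ℕ) (u v : CtBar) :
    (ddt CtBar)^[k] (u + v) = (ddt CtBar)^[k] u + (ddt CtBar)^[k] v :=
  iterate_map_add (ddt CtBar) k u v

theorem iterate_ddt_const_mul (k : ℕ) (c : ℂ) (u : CtBar) :
    (ddt CtBar)^[k] (algebraMap ℂ CtBar c * u) = algebraMap ℂ CtBar c * (ddt CtBar)^[k] u := by
  induction k generalizing u with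
  | zero => rfl
  | succ k ih => simp [Function.iterate_succ_apply, Derivation.leibniz, ih]

theorem iterate_ddt_sum {ι : Type*} (s : Finset ι) (k : ℕ) (u : ι → CtBar) :
    (ddt CtBar)^[k] (∑ i ∈ s, u i) = ∑ i ∈ s, (ddt CtBar)^[k] (u i) := by
  classical
  induction s using Finset.induction_on with
  | empty => simp [iterate_map_zero]
  | insert a s ha ih => rw [Finset.sum_insert ha, Finset.sum_insert ha, iterate_ddt_add, ih]

namespace LinODE

/-! ### The solution space of a linear equation -/

theorem app_sum {ι : Type*} (L : LinODE n) (s : Finset ι) (c : ι → ℂ) (u : ι → CtBar) :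
    L.app (∑ i ∈ s, u i * algebraMap ℂ CtBar (c i)) =
      ∑ i ∈ s, L.app (u i) * algebraMap ℂ CtBar (c i) := by
  simp only [app, iterate_ddt_sum, mul_comm _ (algebraMap ℂ CtBar _), iterate_ddt_const_mul,
    mul_add, Finset.sum_add_distrib, Finset.mul_sum]
  rw [Finset.sum_comm]
  congr 1
  exact Finset.sum_congr rfl fun i _ => Finset.sum_congr rfl fun j _ => by ring

theorem app_algEquiv (L : LinODE n) (σ : CtBar ≃ₐ[Ct] CtBar) (u : CtBar) :
    L.app (σ u) = σ (L.app u) := by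
  have h (k : ℕ) (u : CtBar) : (ddt CtBar)^[k] (σ u) = σ ((ddt CtBar)^[k] u) := by
    induction k generalizing u with
    | zero => rfl
    | succ k ih => rw [Function.iterate_succ_apply, ← algEquiv_ddt, ih, Function.iterate_succ_apply]
  simp [app, h]

/-- The derivatives of order `< n` of an algebraic function. -/
def jet (n : ℕ) (u : CtBar) : Fin n → CtBar := fun k => (ddt CtBar)^[k] u

/-- If the jet of a solution is a combination of linearly independent jets of solutions, then the
coefficients of the combination are constants. -/
theorem coeff_const_of_jet_eq {L : LinODE n} {m : ℕ} {x : Fin m → CtBar}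
    (hx : ∀ j, L.app (x j) = 0) (hli : LinearIndependent CtBar fun j => jet n (x j))
    {z : CtBar} (hz : L.app z = 0) {c : Fin m → CtBar} (hc : jet n z = ∑ j, c j • jet n (x j))
    (j : Fin m) : ddt CtBar (c j) = 0 := by
  have h0 (k : ℕ) (hk : k < n) : (ddt CtBar)^[k] z = ∑ j, c j * (ddt CtBar)^[k] (x j) := by
    simpa [jet] using congrFun hc ⟨k, hk⟩
  -- The equation `L = 0` expresses the `n`-th derivative through the lower ones with the same
  -- coefficients for all solutions.
  have h1 : (ddt CtBar)^[n] z = ∑ j, c j * (ddt CtBar)^[n] (x j) := by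
    have e (u : CtBar) (hu : L.app u = 0) : (ddt CtBar)^[n] u =
        -∑ i : Fin n, algebraMap Ct CtBar (L.coeff i) * (ddt CtBar)^[i] u :=
      eq_neg_of_add_eq_zero_left hu
    rw [e z hz]
    simp only [fun j => e (x j) (hx j), h0 _ (Fin.is_lt _), mul_neg, Finset.sum_neg_distrib,
      Finset.mul_sum]
    rw [Finset.sum_comm]
    exact congrArg _ (Finset.sum_congr rfl fun i _ => Finset.sum_congr rfl fun j _ => by ring)
  have h2 (k : ℕ) (hk : k ≤ n) : (ddt CtBar)^[k] z = ∑ j, c j * (ddt CtBar)^[k] (x j) := by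
    rcases hk.lt_or_eq with hk | rfl
    exacts [h0 k hk, h1]
  -- Differentiate the relation of order `k` and subtract the one of order `k + 1`: only the terms
  -- with `c_j'` remain.
  have h3 : ∑ j, ddt CtBar (c j) • jet n (x j) = 0 := by
    ext k
    have h4 := congrArg (ddt CtBar) (h2 k k.2.le)
    rw [← Function.iterate_succ_apply' (ddt CtBar), h2 _ k.2] at h4
    simp only [map_sum, Derivation.leibniz, smul_eq_mul, Finset.sum_add_distrib,
      ← Function.iterate_succ_apply' (ddt CtBar), left_eq_add] at h4
    simpa [jet, mul_comm] using h4
  exact Fintype.linearIndependent_iff.1 hli _ h3 j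

/-- Solutions that are linearly independent over the constants have linearly independent jets. -/
theorem linearIndependent_jet {L : LinODE n} {m : ℕ} {x : Fin m → CtBar}
    (hx : ∀ j, L.app (x j) = 0) (hli : LinearIndependent ℂ x) :
    LinearIndependent CtBar fun j => jet n (x j) := by
  induction m with
  | zero => exact linearIndependent_empty_type
  | succ m ih =>
    have hli' : LinearIndependent ℂ fun j => x (Fin.succ j) :=
      hli.comp _ (Fin.succ_injective m)
    have ih' := ih (fun j => hx j.succ) hli'
    rw [linearIndependent_finSucc]
    refine ⟨ih', fun hmem => ?_⟩
    obtain ⟨c, hc⟩ := (Submodule.mem_span_range_iff_exists_fun CtBar).1 hmem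
    rw [linearIndependent_finSucc] at hli
    refine hli.2 ((Submodule.mem_span_range_iff_exists_fun ℂ).2 ?_)
    choose d hd using fun j => exists_eq_algebraMap_of_ddt_alg_eq_zero
      (coeff_const_of_jet_eq (fun j => hx j.succ) ih' (hx 0) hc.symm j)
    refine ⟨d, ?_⟩
    -- An operator of order 0 is the identity, so there the only solution is 0.
    rcases Nat.eq_zero_or_pos n with rfl | hn
    · have e (j : Fin (m + 1)) : x j = 0 := by simpa [app] using hx j
      simp [e, Fin.tail]
    · have := congrFun hc ⟨0, hn⟩
      simpa [jet, Fin.tail, hd, Algebra.smul_def] using this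

/-- Every solution is a linear combination of a full system of solutions. -/
theorem IsFullSystem.exists_eq_sum {L : LinODE n} {x : Fin n → CtBar} (hx : L.IsFullSystem x)
    (hn : 0 < n) {z : CtBar} (hz : L.app z = 0) :
    ∃ c : Fin n → ℂ, z = ∑ j, x j * algebraMap ℂ CtBar (c j) := by
  have hli := linearIndependent_jet hx.1 hx.2
  have hspan := hli.span_eq_top_of_card_eq_finrank' (by simp)
  obtain ⟨c, hc⟩ := (Submodule.mem_span_range_iff_exists_fun CtBar).1
    (hspan ▸ Submodule.mem_top (x := jet n z))
  choose d hd using fun j => exists_eq_algebraMap_of_ddt_alg_eq_zero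
      (coeff_const_of_jet_eq hx.1 hli hz hc.symm j)
  refine ⟨d, ?_⟩
  have := congrFun hc ⟨0, hn⟩
  simpa only [jet, hd, mul_comm, Finset.sum_apply, Pi.smul_apply, smul_eq_mul,
    Function.iterate_zero_apply] using this.symm

end LinODE

/-! ### The action of matrices on polynomials -/

theorem substitute_X (g : GL (Fin n) ℂ) (j : Fin n) :
    substitute g (MvPolynomial.X j) =
      ∑ l, (g : Matrix (Fin n) (Fin n) ℂ) l j • MvPolynomial.X l := by
  simp [substitute]

theorem substitute_one : substitute (1 : GL (Fin n) ℂ) = AlgHom.id ℂ _ := by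
  refine MvPolynomial.algHom_ext fun j => ?_
  simp [substitute_X, Matrix.one_apply]

theorem substitute_mul (g h : GL (Fin n) ℂ) :
    substitute (g * h) = (substitute g).comp (substitute h) := by
  refine MvPolynomial.algHom_ext fun j => ?_
  simp only [AlgHom.comp_apply, substitute_X, map_sum, map_smul, Units.val_mul, Matrix.mul_apply,
    Finset.sum_smul, Finset.smul_sum, smul_smul]
  rw [Finset.sum_comm]
  simp only [mul_comm]

theorem isHomogeneous_substitute (g : GL (Fin n) ℂ) {A : MvPolynomial (Fin n) ℂ} {d : ℕ}
    (hA : A.IsHomogeneous d) : (substitute g A).IsHomogeneous d := by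
  have := hA.aeval (g := fun j => ∑ l, (g : Matrix (Fin n) (Fin n) ℂ) l j • MvPolynomial.X l)
    (n := 1) fun j => MvPolynomial.IsHomogeneous.sum _ _ _ fun l _ => by
      rw [MvPolynomial.smul_eq_C_mul]
      exact MvPolynomial.isHomogeneous_C_mul_X _ _
  simpa [substitute] using this

/-- Evaluation of a form of degree `d` at a multiple of a vector. -/
theorem aeval_mul_of_isHomogeneous {S : Type*} [CommRing S] [Algebra ℂ S]
    {A : MvPolynomial (Fin n) ℂ} {d : ℕ} (hA : A.IsHomogeneous d) (c : S) (v : Fin n → S) :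
    MvPolynomial.aeval (fun j => c * v j) A = c ^ d * MvPolynomial.aeval v A := by
  rw [MvPolynomial.aeval_def, MvPolynomial.aeval_def, MvPolynomial.eval₂_eq',
    MvPolynomial.eval₂_eq', Finset.mul_sum]
  refine Finset.sum_congr rfl fun m hm => ?_
  simp only [mul_pow, Finset.prod_mul_distrib, Finset.prod_pow_eq_pow_sum]
  rw [hA.degree_eq_sum_deg_support hm, ← Finsupp.degree_apply, Finsupp.degree_eq_sum]
  ring

theorem mem_invariants {G : Subgroup (GL (Fin n) ℂ)} {A : MvPolynomial (Fin n) ℂ} :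
    A ∈ invariants G ↔ ∀ g ∈ G, substitute g A = A := by
  simp [invariants, Algebra.mem_iInf, AlgHom.mem_equalizer]

theorem mem_invariantForms {G : Subgroup (GL (Fin n) ℂ)} {A : MvPolynomial (Fin n) ℂ} {d : ℕ} :
    A ∈ invariantForms G d ↔ (∀ g ∈ G, substitute g A = A) ∧ A.IsHomogeneous d := by
  simp [invariantForms, mem_invariants]

theorem mul_mem_invariantForms {G : Subgroup (GL (Fin n) ℂ)} {A B : MvPolynomial (Fin n) ℂ}
    {d e : ℕ} (hA : A ∈ invariantForms G d) (hB : B ∈ invariantForms G e) :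
    A * B ∈ invariantForms G (d + e) :=
  ⟨(invariants G).mul_mem hA.1 hB.1, MvPolynomial.IsHomogeneous.mul hA.2 hB.2⟩

theorem pow_mem_invariantForms {G : Subgroup (GL (Fin n) ℂ)} {A : MvPolynomial (Fin n) ℂ}
    {d : ℕ} (hA : A ∈ invariantForms G d) (m : ℕ) : A ^ m ∈ invariantForms G (d * m) :=
  ⟨(invariants G).pow_mem hA.1 m, MvPolynomial.IsHomogeneous.pow hA.2 m⟩

/-! ### The Galois representation -/

theorem coeff_eq_of_sum_eq {x : Fin n → CtBar} (hx : LinearIndependent ℂ x) {a b : Fin n → ℂ}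
    (h : ∑ l, x l * algebraMap ℂ CtBar (a l) = ∑ l, x l * algebraMap ℂ CtBar (b l)) : a = b := by
  have h0 : ∑ l, (a l - b l) • x l = 0 := by
    simp only [Algebra.smul_def, mul_comm _ (x _), map_sub, mul_sub, Finset.sum_sub_distrib, h,
      sub_self]
  funext l
  exact sub_eq_zero.1 (Fintype.linearIndependent_iff.1 hx _ h0 l)

theorem algEquiv_algebraMap (σ : CtBar ≃ₐ[Ct] CtBar) (c : ℂ) :
    σ (algebraMap ℂ CtBar c) = algebraMap ℂ CtBar c :=
  (σ.restrictScalars ℂ).commutes c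

/-- Every automorphism over `ℂ(t)` acts on a full system of solutions by an element of the Galois
representation. -/
theorem LinODE.IsFullSystem.exists_galoisRep {L : LinODE n} {x : Fin n → CtBar}
    (hx : L.IsFullSystem x) (hn : 0 < n) (σ : CtBar ≃ₐ[Ct] CtBar) :
    ∃ g ∈ galoisRep x,
      ∀ j, σ (x j) = ∑ l, x l * algebraMap ℂ CtBar ((g : Matrix (Fin n) (Fin n) ℂ) l j) := by
  have key (τ : CtBar ≃ₐ[Ct] CtBar) : ∃ M : Matrix (Fin n) (Fin n) ℂ,
      ∀ j, τ (x j) = ∑ l, x l * algebraMap ℂ CtBar (M l j) := by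
    choose c hc using fun j => hx.exists_eq_sum hn (z := τ (x j))
      (by rw [L.app_algEquiv, hx.1, map_zero])
    exact ⟨Matrix.of fun l j => c j l, hc⟩
  obtain ⟨M, hM⟩ := key σ
  -- The matrix of `σ⁻¹` provides the inverse of that of `σ`.
  obtain ⟨N, hN⟩ := key σ.symm
  have hNM : N * M = 1 := by
    ext l j
    refine congrFun (coeff_eq_of_sum_eq hx.2 (a := fun l => (N * M) l j)
      (b := fun l => (1 : Matrix (Fin n) (Fin n) ℂ) l j) ?_) l
    have h1 : σ.symm (σ (x j)) = x j := σ.symm_apply_apply _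
    rw [hM, map_sum] at h1
    simp only [map_mul, hN, algEquiv_algebraMap, Finset.sum_mul] at h1
    rw [Finset.sum_comm] at h1
    simp only [Matrix.mul_apply, map_sum, map_mul, Finset.mul_sum, ← mul_assoc]
    rw [h1]
    simp [Matrix.one_apply]
  let g : GL (Fin n) ℂ := ⟨M, N, mul_eq_one_comm.1 hNM, hNM⟩
  exact ⟨g, ⟨σ, algEquiv_ddt σ, hM⟩, hM⟩

/-- Evaluation at the solutions intertwines substitution with the Galois action; hence values of
invariants are Galois-fixed. -/
theorem aeval_substitute {x : Fin n → CtBar} {σ : CtBar ≃ₐ[Ct] CtBar} {g : GL (Fin n) ℂ}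
    (hg : ∀ j, σ (x j) = ∑ l, x l * algebraMap ℂ CtBar ((g : Matrix (Fin n) (Fin n) ℂ) l j))
    (A : MvPolynomial (Fin n) ℂ) :
    MvPolynomial.aeval x (substitute g A) = σ (MvPolynomial.aeval x A) := by
  have h : (MvPolynomial.aeval x).comp (substitute g) =
      ((σ.restrictScalars ℂ : CtBar ≃ₐ[ℂ] CtBar) : CtBar →ₐ[ℂ] CtBar).comp
        (MvPolynomial.aeval x) := by
    refine MvPolynomial.algHom_ext fun j => ?_
    simp [substitute_X, hg, Algebra.smul_def, mul_comm]
  exact congrArg (fun φ => φ A) h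

theorem exists_algebraMap_eq_of_fixed {u : CtBar} (hu : ∀ σ : CtBar ≃ₐ[Ct] CtBar, σ u = u) :
    ∃ r : Ct, algebraMap Ct CtBar r = u :=
  IntermediateField.mem_bot.1 ((InfiniteGalois.mem_bot_iff_fixed u).2 hu)

/-- The value of an invariant at the solutions is a rational function. -/
theorem LinODE.IsFullSystem.exists_algebraMap_eq_aeval {L : LinODE n} {x : Fin n → CtBar}
    (hx : L.IsFullSystem x) (hn : 0 < n) {A : MvPolynomial (Fin n) ℂ}
    (hA : ∀ g ∈ galoisRep x, substitute g A = A) :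
    ∃ r : Ct, algebraMap Ct CtBar r = MvPolynomial.aeval x A := by
  refine exists_algebraMap_eq_of_fixed fun σ => ?_
  obtain ⟨g, hg, hσ⟩ := hx.exists_galoisRep hn σ
  rw [← aeval_substitute hσ, hA g hg]

/-- The Galois representation is finite. -/
theorem finite_galoisRep {x : Fin n → CtBar} (hx : LinearIndependent ℂ x) :
    Finite (galoisRep x) := by
  -- A matrix is determined by the images of the `x_j`, and each image is one of finitely many
  -- roots.
  let F : galoisRep x → (∀ j, (minpoly Ct (x j)).rootSet CtBar) := fun g j =>
    ⟨∑ l, x l * algebraMap ℂ CtBar ((g : GL (Fin n) ℂ) l j), by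
      obtain ⟨σ, -, hσ⟩ := g.2
      rw [← hσ j, Polynomial.mem_rootSet]
      refine ⟨minpoly.ne_zero (Algebra.IsIntegral.isIntegral _), ?_⟩
      rw [Polynomial.aeval_algHom_apply, minpoly.aeval, map_zero]⟩
  refine Finite.of_injective F fun g h hgh => ?_
  ext l j
  exact congrFun (coeff_eq_of_sum_eq hx (congrArg Subtype.val (congrFun hgh j))) l

/-! ### Twisting by functions with rational logarithmic derivative -/

/-- If `x = f y` and the conjugates of `f` are multiples of `f` by `d`-th roots of unity, then the
invariant forms of degree `d` for `x` are invariant forms for `y`. -/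
theorem invariantForms_le_of_mul {x y : Fin n → CtBar} {f : CtBar} (hf : f ≠ 0)
    (hxy : ∀ j, x j = f * y j) {d : ℕ}
    (hσ : ∀ σ : CtBar ≃ₐ[Ct] CtBar, ∃ c : ℂ, c ^ d = 1 ∧ σ f = algebraMap ℂ CtBar c * f) :
    invariantForms (galoisRep x) d ≤ invariantForms (galoisRep y) d := by
  intro A hA
  rw [mem_invariantForms] at hA ⊢
  refine ⟨fun h ⟨σ, hσd, hh⟩ => ?_, hA.2⟩
  obtain ⟨c, hcd, hc⟩ := hσ σ
  have hc0 : c ≠ 0 := by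
    rintro rfl
    rw [map_zero, zero_mul] at hc
    exact hf (σ.injective (hc.trans (map_zero σ).symm))
  -- If `σ` acts on `y` by `h`, it acts on `x = f y` by `c h`; on forms of degree `d` the scalar `c`
  -- acts by `c^d = 1`.
  obtain ⟨g, hg⟩ : ∃ g : GL (Fin n) ℂ, ∀ l j, (g : Matrix (Fin n) (Fin n) ℂ) l j =
      c * (h : Matrix (Fin n) (Fin n) ℂ) l j :=
    ⟨Units.mk0 c hc0 • h, fun l j => by simp [Units.smul_def]⟩
  have hgx : g ∈ galoisRep x := ⟨σ, hσd, fun j => by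
    simp only [hxy, hg, map_mul, hh, hc, Finset.mul_sum]
    exact Finset.sum_congr rfl fun l _ => by ac_rfl⟩
  have h1 : substitute g A = MvPolynomial.C (c ^ d) * substitute h A := by
    have h2 : substitute g = MvPolynomial.aeval fun j => MvPolynomial.C c *
        ∑ l, (h : Matrix (Fin n) (Fin n) ℂ) l j • MvPolynomial.X l :=
      MvPolynomial.algHom_ext fun j => by
        simp [substitute_X, hg, MvPolynomial.smul_eq_C_mul, Finset.mul_sum, mul_assoc]
    rw [h2, aeval_mul_of_isHomogeneous hA.2, map_pow, substitute]
  rw [hcd, map_one, one_mul] at h1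
  rw [← h1, hA.1 g hgx]

/-- A function whose logarithmic derivative is rational is multiplied by constants under the Galois
group. -/
theorem exists_algEquiv_eq_mul {f : CtBar} (hf : f ≠ 0) {r : Ct}
    (hr : f⁻¹ * ddt CtBar f = algebraMap Ct CtBar r) (σ : CtBar ≃ₐ[Ct] CtBar) :
    ∃ c : ℂ, σ f = algebraMap ℂ CtBar c * f := by
  have h1 : ddt CtBar f = algebraMap Ct CtBar r * f := by
    rw [← hr]; field_simp
  have h2 : ddt CtBar (σ f) = algebraMap Ct CtBar r * σ f := by
    rw [← algEquiv_ddt, h1, map_mul, AlgEquiv.commutes]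
  -- Both `f` and `σ f` solve `u' = r u`, so their quotient is a constant.
  obtain ⟨c, hc⟩ := exists_eq_algebraMap_of_ddt_alg_eq_zero (u := σ f / f) (by
    rw [Derivation.leibniz_div, h1, h2, smul_eq_mul, smul_eq_mul, smul_eq_mul]
    ring)
  exact ⟨c, by rw [← hc]; field_simp⟩

/-- The Galois group multiplies an algebraic function whose logarithmic derivative is rational by
roots of unity of bounded order. -/
theorem exists_pow_eq_one_of_logDeriv {f : CtBar} (hf : f ≠ 0) {r : Ct}
    (hr : f⁻¹ * ddt CtBar f = algebraMap Ct CtBar r) :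
    ∃ N : ℕ, 0 < N ∧ ∀ σ : CtBar ≃ₐ[Ct] CtBar,
      ∃ c : ℂ, c ^ N = 1 ∧ σ f = algebraMap ℂ CtBar c * f := by
  have hint : IsIntegral Ct f := Algebra.IsIntegral.isIntegral f
  set p := minpoly Ct f with hp
  refine ⟨p.natDegree, minpoly.natDegree_pos hint, fun σ => ?_⟩
  obtain ⟨c, hc⟩ := exists_algEquiv_eq_mul hf hr σ
  refine ⟨c, ?_, hc⟩
  have h1 : aeval (σ f) p = 0 := by rw [Polynomial.aeval_algHom_apply, minpoly.aeval, map_zero]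
  have hc0 : c ≠ 0 := by
    rintro rfl
    rw [map_zero, zero_mul] at hc
    exact hf (σ.injective (hc.trans (map_zero σ).symm))
  -- Multiplying the roots of `p` by `c⁻¹` gives a monic polynomial of the same degree that vanishes
  -- at `f`, hence `p` itself. Comparing the nonzero constant terms yields `c^deg p = 1`.
  have h2 : aeval f (p.scaleRoots (algebraMap ℂ Ct c⁻¹)) = 0 := by
    have := Polynomial.scaleRoots_aeval_eq_zero (a := σ f) (r := algebraMap ℂ Ct c⁻¹) h1
    rwa [hc, ← IsScalarTower.algebraMap_apply, ← mul_assoc, ← map_mul, inv_mul_cancel₀ hc0,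
      map_one, one_mul] at this
  have h3 : p.scaleRoots (algebraMap ℂ Ct c⁻¹) = p := by
    exact minpoly.unique_of_degree_le_degree_minpoly Ct f
      ((Polynomial.monic_scaleRoots_iff _).2 (minpoly.monic hint)) h2
      (Polynomial.degree_scaleRoots _).le
  have h4 := congrArg (fun q => q.coeff 0) h3
  simp only [Polynomial.coeff_scaleRoots, Nat.sub_zero] at h4
  have h5 : p.coeff 0 ≠ 0 := minpoly.coeff_zero_ne_zero hint hf
  have h6 : algebraMap ℂ Ct c⁻¹ ^ p.natDegree = 1 := by
    exact mul_left_cancel₀ h5 (h4.trans (mul_one _).symm)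
  rw [← map_pow, ← map_one (algebraMap ℂ Ct)] at h6
  have h7 := (algebraMap ℂ Ct).injective h6
  rwa [inv_pow, inv_eq_one] at h7

/-! ### Invariants of finite groups -/

/-- The action of a matrix group on polynomials by substitution. -/
abbrev substituteAction (G : Subgroup (GL (Fin n) ℂ)) :
    MulSemiringAction G (MvPolynomial (Fin n) ℂ) where
  smul g A := substitute (g : GL (Fin n) ℂ) A
  one_smul A := congrArg (fun φ => φ A) substitute_one
  mul_smul g h A := congrArg (fun φ => φ A) (substitute_mul (g : GL (Fin n) ℂ) h)
  smul_zero g := map_zero (substitute (g : GL (Fin n) ℂ))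
  smul_add g := map_add (substitute (g : GL (Fin n) ℂ))
  smul_one g := map_one (substitute (g : GL (Fin n) ℂ))
  smul_mul g := map_mul (substitute (g : GL (Fin n) ℂ))

/-- The ring of invariants of a finite group is finitely generated. -/
theorem fg_invariants (G : Subgroup (GL (Fin n) ℂ)) [Finite G] : (invariants G).FG := by
  let := substituteAction G
  have : Algebra.IsInvariant (invariants G) (MvPolynomial (Fin n) ℂ) G :=
    ⟨fun A hA => ⟨⟨A, mem_invariants.2 fun g hg => hA ⟨g, hg⟩⟩, rfl⟩⟩
  have hint : Algebra.IsIntegral (invariants G) (MvPolynomial (Fin n) ℂ) :=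
    Algebra.IsInvariant.isIntegral (invariants G) (MvPolynomial (Fin n) ℂ) G
  have hft : Algebra.FiniteType (invariants G) (MvPolynomial (Fin n) ℂ) :=
    Algebra.FiniteType.of_restrictScalars_finiteType ℂ _ _
  have hfin : Module.Finite (invariants G) (MvPolynomial (Fin n) ℂ) := Algebra.IsIntegral.finite
  -- Artin–Tate: the polynomial ring is a finite module over the invariants and a finitely generated
  -- `ℂ`-algebra.
  exact (Subalgebra.fg_top _).1 (fg_of_fg_of_fg ℂ (invariants G) (MvPolynomial (Fin n) ℂ)
    Algebra.FiniteType.out hfin.1 Subtype.val_injective)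

theorem substitute_homogeneousComponent (g : GL (Fin n) ℂ) (A : MvPolynomial (Fin n) ℂ) (d : ℕ) :
    substitute g (MvPolynomial.homogeneousComponent d A) =
      MvPolynomial.homogeneousComponent d (substitute g A) := by
  conv_rhs => rw [← MvPolynomial.sum_homogeneousComponent A, map_sum, map_sum]
  simp only [MvPolynomial.homogeneousComponent_of_mem
    (isHomogeneous_substitute g (MvPolynomial.homogeneousComponent_isHomogeneous _ A))]
  rw [Finset.sum_ite_eq]
  split_ifs with h
  · rfl
  · rw [MvPolynomial.homogeneousComponent_eq_zero _ _ (by simpa using h), map_zero]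

theorem homogeneousComponent_mem_invariantForms {G : Subgroup (GL (Fin n) ℂ)}
    {A : MvPolynomial (Fin n) ℂ} (hA : A ∈ invariants G) (d : ℕ) :
    MvPolynomial.homogeneousComponent d A ∈ invariantForms G d :=
  mem_invariantForms.2 ⟨fun g hg => by
    rw [substitute_homogeneousComponent, mem_invariants.1 hA g hg],
    MvPolynomial.homogeneousComponent_isHomogeneous _ _⟩

/-- The ring of invariants of a finite group is generated by finitely many invariant forms of
positive degree. -/
theorem exists_homogeneous_generators (G : Subgroup (GL (Fin n) ℂ)) [Finite G] :
    ∃ (ι : Type) (_ : Fintype ι) (F : ι → MvPolynomial (Fin n) ℂ) (d : ι → ℕ),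
      (∀ i, 0 < d i) ∧ (∀ i, F i ∈ invariantForms G (d i)) ∧
      Algebra.adjoin ℂ (Set.range F) = invariants G := by
  obtain ⟨T, hT⟩ := fg_invariants G
  have hTm (A : T) : (A : MvPolynomial (Fin n) ℂ) ∈ invariants G :=
    hT ▸ Algebra.subset_adjoin A.2
  -- The shift by one discards the components of degree 0, which are scalars.
  let F : (Σ A : T, Fin (A : MvPolynomial (Fin n) ℂ).totalDegree) → MvPolynomial (Fin n) ℂ :=
    fun p => MvPolynomial.homogeneousComponent ((p.2 : ℕ) + 1) (p.1 : MvPolynomial (Fin n) ℂ)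
  refine ⟨(Σ A : T, Fin (A : MvPolynomial (Fin n) ℂ).totalDegree), inferInstance, F,
    fun p => (p.2 : ℕ) + 1, fun p => Nat.succ_pos _,
    fun p => homogeneousComponent_mem_invariantForms (hTm p.1) _, le_antisymm ?_ ?_⟩
  · rw [Algebra.adjoin_le_iff]
    rintro _ ⟨p, rfl⟩
    exact (homogeneousComponent_mem_invariantForms (hTm p.1) _).1
  · conv_lhs => rw [← hT]
    rw [Algebra.adjoin_le_iff]
    intro A hA
    rw [SetLike.mem_coe, ← MvPolynomial.sum_homogeneousComponent A]
    refine Subalgebra.sum_mem _ fun i hi => ?_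
    rcases i with _ | i
    · rw [MvPolynomial.homogeneousComponent_zero]
      exact Subalgebra.algebraMap_mem _ _
    · refine Algebra.subset_adjoin ⟨⟨⟨A, hA⟩, ⟨i, ?_⟩⟩, rfl⟩
      simpa using hi

theorem prod_pow_mem_invariantForms {G : Subgroup (GL (Fin n) ℂ)} {ι : Type} [Fintype ι]
    {F : ι → MvPolynomial (Fin n) ℂ} {d : ι → ℕ} (hF : ∀ i, F i ∈ invariantForms G (d i))
    (m : ι → ℕ) : ∏ i, F i ^ m i ∈ invariantForms G (∑ i, m i * d i) := by
  refine ⟨(invariants G).prod_mem fun i _ => (invariants G).pow_mem (hF i).1 _,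
    MvPolynomial.IsHomogeneous.prod _ _ _ fun i _ => ?_⟩
  rw [mul_comm]
  exact MvPolynomial.IsHomogeneous.pow (hF i).2 _

/-! ### Veronese subrings and coordinate degrees -/

/-- A monomial of large degree in generators of degrees dividing `N` splits off factors of
degree `N`. -/
theorem prod_pow_mem_mul_pow {G : Subgroup (GL (Fin n) ℂ)} {ι : Type} [Fintype ι]
    {F : ι → MvPolynomial (Fin n) ℂ} {d : ι → ℕ} (hd : ∀ i, 0 < d i)
    (hF : ∀ i, F i ∈ invariantForms G (d i)) {N : ℕ} (hN : 0 < N) (hdN : ∀ i, d i ∣ N) {s : ℕ}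
    (hs : Fintype.card ι ≤ s) (j : ℕ) (m : ι → ℕ) (hm : ∑ i, m i * d i = (s + j) * N) :
    ∏ i, F i ^ m i ∈ invariantForms G (s * N) * invariantForms G N ^ j := by
  classical
  induction j generalizing m with
  | zero =>
    rw [pow_zero, mul_one]
    simpa [hm] using prod_pow_mem_invariantForms hF m
  | succ j ih =>
    -- Pigeonhole: if every factor had degree below `N`, the total would be at most `card ι * N`,
    -- which is too small. The power of `F i` of degree exactly `N` can then be split off.
    obtain ⟨i, hi⟩ : ∃ i, N ≤ m i * d i := by
      by_contra! h
      have h1 : ∑ i, m i * d i ≤ ∑ _i : ι, N := Finset.sum_le_sum fun i _ => (h i).le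
      rw [hm, Finset.sum_const, Finset.card_univ, smul_eq_mul] at h1
      nlinarith [Nat.le_of_mul_le_mul_right h1 hN]
    obtain ⟨q, hq⟩ := hdN i
    have hqm : q ≤ m i := by
      rw [hq, mul_comm] at hi
      exact Nat.le_of_mul_le_mul_right hi (hd i)
    obtain ⟨m', hm'⟩ : ∃ m' : ι → ℕ, m = m' + Pi.single i q := by
      refine ⟨m - Pi.single i q, ?_⟩
      funext k
      by_cases hk : k = i
      · subst hk; simp [hqm]
      · simp [hk]
    subst hm'
    have e1 : ∏ k, F k ^ (m' + Pi.single i q : ι → ℕ) k = (∏ k, F k ^ m' k) * F i ^ q := by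
      simp only [Pi.add_apply, pow_add, Finset.prod_mul_distrib]
      congr 1
      rw [Finset.prod_eq_single i (fun k _ hk => by simp [hk]) (by simp)]
      simp
    have e2 : ∑ k, m' k * d k = (s + j) * N := by
      have e3 : ∑ k, (m' + Pi.single i q : ι → ℕ) k * d k = ∑ k, m' k * d k + q * d i := by
        simp only [Pi.add_apply, add_mul, Finset.sum_add_distrib]
        congr 1
        rw [Finset.sum_eq_single i (fun k _ hk => by simp [hk]) (by simp)]
        simp
      rw [e3, mul_comm q, ← hq] at hm
      have : (s + (j + 1)) * N = (s + j) * N + N := by ring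
      omega
    rw [e1, pow_succ, ← mul_assoc]
    refine Submodule.mul_mem_mul (ih m' e2) ?_
    rw [hq]
    exact pow_mem_invariantForms (hF i) q

/-- An invariant form is a combination of monomials of the same degree in the generators. -/
theorem mem_span_prod_pow {G : Subgroup (GL (Fin n) ℂ)} {ι : Type} [Fintype ι]
    {F : ι → MvPolynomial (Fin n) ℂ} {d : ι → ℕ} (hF : ∀ i, F i ∈ invariantForms G (d i))
    (hgen : Algebra.adjoin ℂ (Set.range F) = invariants G) {A : MvPolynomial (Fin n) ℂ} {D : ℕ}
    (hA : A ∈ invariantForms G D) :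
    A ∈ Submodule.span ℂ {M | ∃ m : ι → ℕ, ∑ i, m i * d i = D ∧ M = ∏ i, F i ^ m i} := by
  have h1 : A ∈ Algebra.adjoin ℂ (Set.range F) := hgen ▸ hA.1
  rw [Algebra.adjoin_range_eq_range_aeval] at h1
  obtain ⟨p, hp⟩ := h1
  have h2 : A = MvPolynomial.homogeneousComponent D A :=
    (MvPolynomial.homogeneousComponent_eq_self hA.2).symm
  rw [h2, ← hp]
  clear h2 hp hA
  induction p using MvPolynomial.induction_on' with
  | add p q hp hq =>
    rw [map_add, map_add]
    exact Submodule.add_mem _ hp hq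
  | monomial m c =>
    change MvPolynomial.homogeneousComponent D (MvPolynomial.aeval F (MvPolynomial.monomial m c)) ∈ _
    rw [MvPolynomial.aeval_monomial, MvPolynomial.algebraMap_eq, MvPolynomial.homogeneousComponent_C_mul,
      Finsupp.prod_fintype _ _ (fun i => pow_zero _),
      MvPolynomial.homogeneousComponent_of_mem (prod_pow_mem_invariantForms hF m).2]
    split_ifs with h
    · rw [← MvPolynomial.smul_eq_C_mul]
      exact Submodule.smul_mem _ _ (Submodule.subset_span ⟨m, h.symm, rfl⟩)
    · rw [mul_zero]
      exact Submodule.zero_mem _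

theorem invariantForms_pow_le (G : Subgroup (GL (Fin n) ℂ)) (d s : ℕ) :
    invariantForms G d ^ s ≤ invariantForms G (s * d) := by
  induction s with
  | zero =>
    rw [pow_zero, zero_mul, Submodule.one_le]
    exact ⟨(invariants G).one_mem, MvPolynomial.isHomogeneous_one _ _⟩
  | succ s ih =>
    rw [pow_succ, Nat.succ_mul]
    exact Submodule.mul_le.2 fun A hA B hB => mul_mem_invariantForms (ih hA) hB

/-- Veronese subrings of sufficiently divisible degree are generated in degree one. -/
theorem exists_invariantForms_le_pow (G : Subgroup (GL (Fin n) ℂ)) [Finite G] :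
    ∃ M : ℕ, 0 < M ∧ ∀ Λ : ℕ, 0 < Λ → M ∣ Λ → ∀ k,
      invariantForms G (k * Λ) ≤ invariantForms G Λ ^ k := by
  obtain ⟨ι, hι, F, d, hd, hF, hgen⟩ := exists_homogeneous_generators G
  set N := ∏ i, d i with hNdef
  have hN : 0 < N := Finset.prod_pos fun i _ => hd i
  have hdN (i : ι) : d i ∣ N := Finset.dvd_prod_of_mem _ (Finset.mem_univ i)
  -- Any multiple is `s * N` with `s ≥ card ι`, as `prod_pow_mem_mul_pow` requires; the `+ 1` keeps
  -- the number positive when there are no generators.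
  refine ⟨(Fintype.card ι + 1) * N, Nat.mul_pos (Nat.succ_pos _) hN, ?_⟩
  rintro Λ hΛ ⟨b, rfl⟩ k A hA
  have hb : 0 < b := Nat.pos_of_mul_pos_left hΛ
  set s := (Fintype.card ι + 1) * b with hsdef
  have hs : Fintype.card ι ≤ s := by nlinarith
  have hsN : (Fintype.card ι + 1) * N * b = s * N := by rw [hsdef]; ring
  rw [hsN] at hA hΛ ⊢
  refine Submodule.span_le.2 ?_ (mem_span_prod_pow hF hgen hA)
  rintro _ ⟨m, hm, rfl⟩
  rcases k with _ | k
  · rw [zero_mul, Finset.sum_eq_zero_iff] at hm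
    have h0 (i : ι) : m i = 0 :=
      (Nat.mul_eq_zero.1 (hm i (Finset.mem_univ i))).resolve_right (hd i).ne'
    simp [h0, Submodule.one_le.1 le_rfl]
  · have h1 := prod_pow_mem_mul_pow hd hF hN hdN hs (s * k) m (by rw [hm]; ring)
    rw [pow_mul] at h1
    rw [pow_succ']
    exact mul_le_mul' le_rfl (pow_le_pow_left' (invariantForms_pow_le G N s) k) h1

/-- The invariants of degree `|G|` of a finite group have no common zero. -/
theorem exists_invariantForm_eval_ne_zero (G : Subgroup (GL (Fin n) ℂ)) [Finite G]
    {v : Fin n → ℂ} (hv : v ≠ 0) :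
    ∃ P ∈ invariantForms G (Nat.card G), MvPolynomial.eval v P ≠ 0 := by
  have := Fintype.ofFinite G
  have hw (g : G) : Matrix.vecMul v ((g : GL (Fin n) ℂ) : Matrix (Fin n) (Fin n) ℂ) ≠ 0 := by
    intro h
    apply hv
    have h1 := congrArg (fun w => Matrix.vecMul w
      (((g : GL (Fin n) ℂ)⁻¹ : GL (Fin n) ℂ) : Matrix (Fin n) (Fin n) ℂ)) h
    simpa only [Matrix.vecMul_vecMul, Matrix.zero_vecMul, ← Units.val_mul, mul_inv_cancel,
      Units.val_one, Matrix.vecMul_one] using h1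
  -- Some linear form is nonzero at all the finitely many points of the orbit of `v`; the product of
  -- its translates is the required invariant.
  obtain ⟨φ, hφ⟩ := Module.exists_dual_forall_apply_ne_zero (K := ℂ)
    (fun g : G => Matrix.vecMul v ((g : GL (Fin n) ℂ) : Matrix (Fin n) (Fin n) ℂ)) hw
  let ℓ : MvPolynomial (Fin n) ℂ := ∑ j, MvPolynomial.C (φ (Pi.single j 1)) * MvPolynomial.X j
  have hℓ (w : Fin n → ℂ) : MvPolynomial.eval w ℓ = φ w := by
    conv_rhs => rw [← Finset.univ_sum_single w, map_sum]
    simp only [ℓ, map_sum, map_mul, MvPolynomial.eval_C, MvPolynomial.eval_X]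
    refine Finset.sum_congr rfl fun j _ => ?_
    have : (Pi.single j (w j) : Fin n → ℂ) = w j • Pi.single j 1 := by
      rw [← Pi.single_smul, smul_eq_mul, mul_one]
    rw [this, map_smul, smul_eq_mul, mul_comm]
  have hev (g : GL (Fin n) ℂ) (A : MvPolynomial (Fin n) ℂ) :
      MvPolynomial.eval v (substitute g A) =
        MvPolynomial.eval (Matrix.vecMul v (g : Matrix (Fin n) (Fin n) ℂ)) A := by
    have h : (MvPolynomial.aeval v).comp (substitute g) =
        MvPolynomial.aeval (R := ℂ) (Matrix.vecMul v (g : Matrix (Fin n) (Fin n) ℂ)) := by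
      refine MvPolynomial.algHom_ext fun j => ?_
      simp [substitute_X, Matrix.vecMul, dotProduct, mul_comm]
    simpa [MvPolynomial.aeval_eq_eval] using congrArg (fun ψ => ψ A) h
  refine ⟨∏ g : G, substitute (g : GL (Fin n) ℂ) ℓ, mem_invariantForms.2 ⟨fun h hh => ?_, ?_⟩, ?_⟩
  · rw [map_prod]
    simp only [← AlgHom.comp_apply, ← substitute_mul]
    exact Fintype.prod_equiv (Equiv.mulLeft (⟨h, hh⟩ : G)) _ _ fun g => rfl
  · have hℓh : ℓ.IsHomogeneous 1 := MvPolynomial.IsHomogeneous.sum _ _ _ fun j _ =>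
      MvPolynomial.isHomogeneous_C_mul_X _ _
    have := MvPolynomial.IsHomogeneous.prod Finset.univ
      (fun g : G => substitute (g : GL (Fin n) ℂ) ℓ) (fun _ => 1)
      fun g _ => isHomogeneous_substitute _ hℓh
    simpa using this
  · rw [map_prod]
    refine Finset.prod_ne_zero_iff.2 fun g _ => ?_
    rw [hev, hℓ]
    exact hφ g

/-- For a finite group, all sufficiently divisible degrees are coordinate degrees. -/
theorem exists_isCoordinateDegree (G : Subgroup (GL (Fin n) ℂ)) [Finite G] :
    ∃ M : ℕ, 0 < M ∧ ∀ Λ : ℕ, 0 < Λ → M ∣ Λ → IsCoordinateDegree G Λ := by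
  obtain ⟨M, hM, h⟩ := exists_invariantForms_le_pow G
  -- The factor `M` gives generation in degree one, so no power of `P` is needed (exponent 0); the
  -- factor `|G|` excludes common zeros.
  refine ⟨M * Nat.card G, Nat.mul_pos hM Nat.card_pos, fun Λ hΛ hdvd => ⟨hΛ, fun v hv => ?_,
    fun P _ k A hA => ⟨0, ?_⟩⟩⟩
  · obtain ⟨P, hP, hPv⟩ := exists_invariantForm_eval_ne_zero G hv
    obtain ⟨b, rfl⟩ := (dvd_mul_left _ _).trans hdvd
    exact ⟨P ^ b, pow_mem_invariantForms hP b, by rw [map_pow]; exact pow_ne_zero _ hPv⟩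
  · rw [pow_zero, mul_one, add_zero]
    exact h Λ hΛ ((dvd_mul_right _ _).trans hdvd) k hA

/-! ### Forms with affine values and independent gradients -/

/-- Differentiating `w^d = 1` gives `w' = 0`. -/
theorem exists_root_of_unity_eq {w : CtBar} {d : ℕ} (hd : 0 < d) (hw : w ^ d = 1) :
    ∃ c : ℂ, c ^ d = 1 ∧ w = algebraMap ℂ CtBar c := by
  have hw0 : w ≠ 0 := by
    rintro rfl
    rw [zero_pow hd.ne'] at hw
    exact zero_ne_one hw
  have h1 : ddt CtBar (w ^ d) = 0 := by rw [hw, Derivation.map_one_eq_zero]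
  rw [Derivation.leibniz_pow, smul_eq_mul, nsmul_eq_mul] at h1
  have h2 : ddt CtBar w = 0 := by
    have hdK : (d : CtBar) ≠ 0 := Nat.cast_ne_zero.2 hd.ne'
    exact ((mul_eq_zero.1 h1).resolve_left hdK |> mul_eq_zero.1).resolve_left (pow_ne_zero _ hw0)
  obtain ⟨c, rfl⟩ := exists_eq_algebraMap_of_ddt_alg_eq_zero h2
  refine ⟨c, (algebraMap ℂ CtBar).injective ?_, rfl⟩
  rw [map_pow, hw, map_one]

/-- The coordinate `t` as an algebraic function. -/
abbrev tBar : CtBar := algebraMap Ct CtBar RatFunc.X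

theorem algebraMap_polynomial_eq_aeval (p : ℂ[X]) :
    algebraMap Ct CtBar (algebraMap ℂ[X] Ct p) = aeval tBar p := by
  have h : ((Algebra.ofId Ct CtBar).restrictScalars ℂ).comp
      (IsScalarTower.toAlgHom ℂ ℂ[X] Ct) = aeval tBar := by
    refine Polynomial.algHom_ext ?_
    simp [Algebra.ofId_apply]
  exact congrArg (fun φ => φ p) h

/-- The homogenization in degree `N` of `p(A/B)`. -/
def homogenize (A B : MvPolynomial (Fin n) ℂ) (N : ℕ) (p : ℂ[X]) : MvPolynomial (Fin n) ℂ :=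
  ∑ i ∈ Finset.range (N + 1), p.coeff i • (A ^ i * B ^ (N - i))

theorem homogenize_mem {G : Subgroup (GL (Fin n) ℂ)} {A B : MvPolynomial (Fin n) ℂ} {Λ : ℕ}
    (hA : A ∈ invariantForms G Λ) (hB : B ∈ invariantForms G Λ) (N : ℕ) (p : ℂ[X]) :
    homogenize A B N p ∈ invariantForms G (Λ * N) := by
  refine Submodule.sum_mem _ fun i hi => Submodule.smul_mem _ _ ?_
  have h := mul_mem_invariantForms (pow_mem_invariantForms hA i)
    (pow_mem_invariantForms hB (N - i))
  rwa [← mul_add, Nat.add_sub_cancel' (Nat.lt_succ_iff.1 (Finset.mem_range.1 hi))] at h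

theorem aeval_homogenize {A B : MvPolynomial (Fin n) ℂ} {y : Fin n → CtBar}
    (hA : MvPolynomial.aeval y A = tBar) (hB : MvPolynomial.aeval y B = 1) {N : ℕ} {p : ℂ[X]}
    (hp : p.natDegree ≤ N) : MvPolynomial.aeval y (homogenize A B N p) = aeval tBar p := by
  rw [homogenize, map_sum, Polynomial.aeval_eq_sum_range' (Nat.lt_succ_iff.2 hp)]
  exact Finset.sum_congr rfl fun i _ => by
    rw [map_smul, map_mul, map_pow, map_pow, hA, hB, one_pow, mul_one]

/-! ### Derivations at the point `y` -/

section PointDerivation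

variable {y : Fin n → CtBar} {D : MvPolynomial (Fin n) ℂ →ₗ[ℂ] CtBar}

theorem pointDerivation_one
    (hD : ∀ P Q, D (P * Q) = MvPolynomial.aeval y P * D Q + MvPolynomial.aeval y Q * D P) :
    D 1 = 0 := by
  simpa using hD 1 1

theorem pointDerivation_pow
    (hD : ∀ P Q, D (P * Q) = MvPolynomial.aeval y P * D Q + MvPolynomial.aeval y Q * D P)
    (P : MvPolynomial (Fin n) ℂ) (m : ℕ) :
    D (P ^ m) = m * MvPolynomial.aeval y P ^ (m - 1) * D P := by
  induction m with
  | zero => simpa using pointDerivation_one hD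
  | succ m ih =>
    rw [pow_succ, hD, ih, map_pow]
    rcases m with _ | m
    · simp
    · push_cast
      ring

theorem pointDerivation_homogenize
    (hD : ∀ P Q, D (P * Q) = MvPolynomial.aeval y P * D Q + MvPolynomial.aeval y Q * D P)
    {A B : MvPolynomial (Fin n) ℂ} (hA : D A = 0) (hB : D B = 0) (N : ℕ) (p : ℂ[X]) :
    D (homogenize A B N p) = 0 := by
  rw [homogenize, map_sum]
  refine Finset.sum_eq_zero fun i _ => ?_
  rw [map_smul, hD, pointDerivation_pow hD, pointDerivation_pow hD, hA, hB]
  simp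

/-- If a point derivation kills the coefficients of `p`, then it satisfies the chain rule
for `p`. -/
theorem pointDerivation_eval
    (hD : ∀ P Q, D (P * Q) = MvPolynomial.aeval y P * D Q + MvPolynomial.aeval y Q * D P)
    {p : (MvPolynomial (Fin n) ℂ)[X]} (hp : ∀ i, D (p.coeff i) = 0) (u : MvPolynomial (Fin n) ℂ) :
    D (p.eval u) = MvPolynomial.aeval y ((derivative p).eval u) * D u := by
  rw [Polynomial.eval_eq_sum_range, map_sum, derivative_eval,
    Polynomial.sum_over_range' _ (by simp) _ (Nat.lt_succ_self _), map_sum, Finset.sum_mul]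
  refine Finset.sum_congr rfl fun i _ => ?_
  rw [hD, hp, pointDerivation_pow hD]
  simp
  ring

/-- A point derivation at `y` that kills all invariant forms with affine values at `y`, of degree
divisible by `Λ`, kills all invariant forms of degree divisible by `Λ`. -/
theorem pointDerivation_invariantForms_eq_zero {G : Subgroup (GL (Fin n) ℂ)}
    (hD : ∀ P Q, D (P * Q) = MvPolynomial.aeval y P * D Q + MvPolynomial.aeval y Q * D P)
    (hval : ∀ Q ∈ invariants G, ∃ r : Ct, algebraMap Ct CtBar r = MvPolynomial.aeval y Q)
    {Λ : ℕ} {A B : MvPolynomial (Fin n) ℂ} (hA : A ∈ invariantForms G Λ)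
    (hB : B ∈ invariantForms G Λ) (hAy : MvPolynomial.aeval y A = tBar)
    (hBy : MvPolynomial.aeval y B = 1)
    (hkill : ∀ k, 0 < k → ∀ Q ∈ invariantForms G (Λ * k), (∃ a b : ℂ, MvPolynomial.aeval y Q =
      algebraMap ℂ CtBar a + algebraMap ℂ CtBar b * tBar) → D Q = 0)
    {k : ℕ} (hk : 0 < k) {Q : MvPolynomial (Fin n) ℂ} (hQ : Q ∈ invariantForms G (Λ * k)) :
    D Q = 0 := by
  have hDA : D A = 0 := hkill 1 one_pos A (by rwa [mul_one]) ⟨0, 1, by simp [hAy]⟩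
  have hDB : D B = 0 := hkill 1 one_pos B (by rwa [mul_one]) ⟨1, 0, by simp [hBy]⟩
  obtain ⟨r, hr⟩ := hval Q hQ.1
  set N := r.num.natDegree + r.denom.natDegree
  have h1 := aeval_homogenize hAy hBy (p := r.num) (N := N) (Nat.le_add_right _ _)
  have h2 := aeval_homogenize hAy hBy (p := r.denom) (N := N) (Nat.le_add_left _ _)
  have hden : aeval tBar r.denom ≠ 0 := by
    rw [← algebraMap_polynomial_eq_aeval]
    simpa using r.denom_ne_zero
  have hrel : aeval tBar r.denom * algebraMap Ct CtBar r = aeval tBar r.num := by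
    rw [← algebraMap_polynomial_eq_aeval] at hden
    conv_lhs => rw [← r.num_div_denom]
    rw [← algebraMap_polynomial_eq_aeval, ← algebraMap_polynomial_eq_aeval, map_div₀,
      r.num_div_denom, mul_div_cancel₀ _ hden]
  -- With `r = num/den`, this form vanishes at `y`, and 0 is an affine value. By Leibniz, its image
  -- under `D` is `den(t) * D Q`, since `D` kills `B` and both homogenizations.
  have hZ := hkill (N + k) (Nat.add_pos_right _ hk)
    (homogenize A B N r.denom * Q - homogenize A B N r.num * B ^ k)
    (Submodule.sub_mem _
      (by rw [mul_add]; exact mul_mem_invariantForms (homogenize_mem hA hB _ _) hQ)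
      (by
        rw [mul_add]
        exact mul_mem_invariantForms (homogenize_mem hA hB _ _) (pow_mem_invariantForms hB k)))
    ⟨0, 0, by rw [map_sub, map_mul, map_mul, h1, h2, ← hr, hrel, map_pow, hBy]; simp⟩
  rw [map_sub, hD, hD, pointDerivation_homogenize hD hDA hDB, pointDerivation_homogenize hD hDA hDB,
    pointDerivation_pow hD, hDB, h2] at hZ
  simpa [hden] using hZ

/-- The polynomial with the orbit of `u` under `G` as its simple roots. -/
def orbitPolynomial (G : Subgroup (GL (Fin n) ℂ)) [Finite G] (u : MvPolynomial (Fin n) ℂ) :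
    (MvPolynomial (Fin n) ℂ)[X] :=
  ∏ v ∈ (Set.finite_range fun g : G => substitute (g : GL (Fin n) ℂ) u).toFinset, (X - C v)

/-- Substitution by an element of `G` permutes the roots. -/
theorem orbitPolynomial_coeff_mem_invariants (G : Subgroup (GL (Fin n) ℂ)) [Finite G]
    (u : MvPolynomial (Fin n) ℂ) (i : ℕ) : (orbitPolynomial G u).coeff i ∈ invariants G := by
  refine mem_invariants.2 fun h hh => ?_
  have hinj : Function.Injective (substitute h) := by
    refine Function.LeftInverse.injective (g := substitute h⁻¹) fun A => ?_
    rw [← AlgHom.comp_apply, ← substitute_mul, inv_mul_cancel, substitute_one, AlgHom.id_apply]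
  have hmap : (orbitPolynomial G u).map (substitute h : MvPolynomial (Fin n) ℂ →+* _) =
      orbitPolynomial G u := by
    rw [orbitPolynomial, Polynomial.map_prod]
    simp only [Polynomial.map_sub, Polynomial.map_X, Polynomial.map_C]
    refine Finset.prod_bij (fun v _ => substitute h v) ?_ (fun _ _ _ _ e => hinj e) ?_
      (fun _ _ => rfl)
    · intro v hv
      obtain ⟨g, rfl⟩ := (Set.Finite.mem_toFinset _).1 hv
      refine (Set.Finite.mem_toFinset _).2 ⟨⟨h, hh⟩ * g, ?_⟩
      exact congrArg (fun φ => φ u) (substitute_mul h g)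
    · intro v hv
      obtain ⟨g, rfl⟩ := (Set.Finite.mem_toFinset _).1 hv
      refine ⟨_, (Set.Finite.mem_toFinset _).2 ⟨⟨h, hh⟩⁻¹ * g, rfl⟩, ?_⟩
      rw [← AlgHom.comp_apply, ← substitute_mul]
      simp
  conv_rhs => rw [← hmap]
  rw [Polynomial.coeff_map]
  rfl

/-- The coefficients are, up to sign, elementary symmetric functions of roots of degree `d`. -/
theorem orbitPolynomial_coeff_isHomogeneous (G : Subgroup (GL (Fin n) ℂ)) [Finite G]
    {u : MvPolynomial (Fin n) ℂ} {d : ℕ} (hu : u.IsHomogeneous d) {i : ℕ}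
    (hi : i ≤ (orbitPolynomial G u).natDegree) :
    ((orbitPolynomial G u).coeff i).IsHomogeneous (d * ((orbitPolynomial G u).natDegree - i)) := by
  rw [orbitPolynomial, Polynomial.natDegree_finsetProd_X_sub_C_eq_card] at *
  simp only [sub_eq_add_neg, ← map_neg]
  rw [Finset.prod_X_add_C_coeff _ _ hi]
  refine MvPolynomial.IsHomogeneous.sum _ _ _ fun s hs => ?_
  obtain ⟨hs1, hs2⟩ := Finset.mem_powersetCard.1 hs
  have := MvPolynomial.IsHomogeneous.prod s (fun v => -v) (fun _ => d) fun v hv => by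
    obtain ⟨g, rfl⟩ := (Set.Finite.mem_toFinset _).1 (hs1 hv)
    exact (isHomogeneous_substitute _ hu).neg
  rwa [Finset.sum_const, hs2, smul_eq_mul, mul_comm] at this

/-- A point derivation at `y` that kills all invariant forms with affine values at `y`, of degree
divisible by `Λ`, is zero. -/
theorem pointDerivation_X_eq_zero {G : Subgroup (GL (Fin n) ℂ)} [Finite G]
    (hy : LinearIndependent ℂ y)
    (hD : ∀ P Q, D (P * Q) = MvPolynomial.aeval y P * D Q + MvPolynomial.aeval y Q * D P)
    {Λ : ℕ} (hΛ : 0 < Λ)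
    (hkill : ∀ k, 0 < k → ∀ Q ∈ invariantForms G (Λ * k), D Q = 0) (j : Fin n) :
    D (MvPolynomial.X j) = 0 := by
  classical
  -- The power `Λ` puts the coefficients of the orbit polynomial in degrees divisible by `Λ`, where
  -- `D` is known to vanish.
  set u : MvPolynomial (Fin n) ℂ := MvPolynomial.X j ^ Λ with hu
  have huh : u.IsHomogeneous Λ := MvPolynomial.isHomogeneous_X_pow j Λ
  set p := orbitPolynomial G u with hp
  have hmem : u ∈ (Set.finite_range fun g : G => substitute (g : GL (Fin n) ℂ) u).toFinset :=
    (Set.Finite.mem_toFinset _).2 ⟨1, congrArg (fun φ => φ u) substitute_one⟩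
  have hmonic : p.Monic := Polynomial.monic_prod_of_monic _ _ fun v _ => Polynomial.monic_X_sub_C v
  have hcoeff (i : ℕ) : D (p.coeff i) = 0 := by
    rcases lt_trichotomy i p.natDegree with hi | rfl | hi
    · exact hkill _ (Nat.sub_pos_of_lt hi) _
        ⟨orbitPolynomial_coeff_mem_invariants G u i, orbitPolynomial_coeff_isHomogeneous G huh hi.le⟩
    · rw [hmonic.coeff_natDegree, pointDerivation_one hD]
    · rw [Polynomial.coeff_eq_zero_of_natDegree_lt hi, map_zero]
  have h1 := pointDerivation_eval hD hcoeff u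
  have hpeq : p = (X - C u) * ∏ v ∈ (Set.finite_range
      fun g : G => substitute (g : GL (Fin n) ℂ) u).toFinset.erase u, (X - C v) := by
    rw [hp, orbitPolynomial, ← Finset.mul_prod_erase _ (fun v => X - C v) hmem]
  have h2 : p.eval u = 0 := by rw [hpeq]; simp
  have h3 : (derivative p).eval u = ∏ v ∈ (Set.finite_range
      fun g : G => substitute (g : GL (Fin n) ℂ) u).toFinset.erase u, (u - v) := by
    rw [hpeq, derivative_mul]
    simp [Polynomial.eval_prod]
  have hyj : y j ≠ 0 := hy.ne_zero j
  -- The root `u` stays simple at `y`: if `g u` and `u` agree at `y`, then `g X_j` and `X_j` differ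
  -- there by a constant `c` with `c^Λ = 1`. Independence of `y` gives `g X_j = c X_j`, so `g u =
  -- u`.
  have h4 : MvPolynomial.aeval y ((derivative p).eval u) ≠ 0 := by
    rw [h3, map_prod]
    refine Finset.prod_ne_zero_iff.2 fun v hv h0 => ?_
    obtain ⟨hne, hv⟩ := Finset.mem_erase.1 hv
    obtain ⟨g, rfl⟩ := (Set.Finite.mem_toFinset _).1 hv
    apply hne
    have hl : MvPolynomial.aeval y (substitute (g : GL (Fin n) ℂ) (MvPolynomial.X j)) =
        ∑ l, y l * algebraMap ℂ CtBar ((g : GL (Fin n) ℂ) l j) := by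
      simp [substitute_X, Algebra.smul_def, mul_comm]
    have hpow : (MvPolynomial.aeval y (substitute (g : GL (Fin n) ℂ) (MvPolynomial.X j)) / y j) ^ Λ
        = 1 := by
      rw [map_sub, sub_eq_zero, hu] at h0
      simp only [map_pow, MvPolynomial.aeval_X] at h0
      rw [div_pow, ← h0, div_self (pow_ne_zero _ hyj)]
    obtain ⟨c, hcΛ, hc⟩ := exists_root_of_unity_eq hΛ hpow
    have hcol : (fun l => ((g : GL (Fin n) ℂ) l j : ℂ)) = fun l => if l = j then c else 0 := by
      refine coeff_eq_of_sum_eq hy ?_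
      rw [← hl, (div_eq_iff hyj).1 hc]
      simp [apply_ite (algebraMap ℂ CtBar), mul_comm]
    have hX : substitute (g : GL (Fin n) ℂ) (MvPolynomial.X j) = c • MvPolynomial.X j := by
      rw [substitute_X]
      simp [fun l => congrFun hcol l]
    change substitute (g : GL (Fin n) ℂ) u = u
    rw [hu, map_pow, hX, _root_.smul_pow, hcΛ, one_smul]
  rw [h2, map_zero] at h1
  have h5 := (mul_eq_zero.1 h1.symm).resolve_left h4
  rw [hu, pointDerivation_pow hD, MvPolynomial.aeval_X] at h5
  refine (mul_eq_zero.1 h5).resolve_left (mul_ne_zero (Nat.cast_ne_zero.2 hΛ.ne') ?_)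
  exact pow_ne_zero _ hyj

end PointDerivation

/-! ### Gradients of affine-valued forms -/

/-- The gradient of a form, evaluated at `y`. -/
def gradAt (y : Fin n → CtBar) : MvPolynomial (Fin n) ℂ →ₗ[ℂ] (Fin n → CtBar) where
  toFun Q j := MvPolynomial.aeval y (MvPolynomial.pderiv j Q)
  map_add' P Q := by ext j; simp
  map_smul' c Q := by ext j; simp

theorem gradAt_mul (y : Fin n → CtBar) (P Q : MvPolynomial (Fin n) ℂ) :
    gradAt y (P * Q) =
      MvPolynomial.aeval y P • gradAt y Q + MvPolynomial.aeval y Q • gradAt y P := by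
  ext j
  simp [gradAt]

theorem gradAt_pow_of_aeval_eq_one {y : Fin n → CtBar} {B : MvPolynomial (Fin n) ℂ}
    (hB : MvPolynomial.aeval y B = 1) (m : ℕ) : gradAt y (B ^ m) = (m : CtBar) • gradAt y B := by
  ext j
  simp [gradAt, hB]

/-- The space spanned by the gradients at `y` of the invariant forms of degree `d` that have affine
values at `y`. -/
def gradSpan (G : Subgroup (GL (Fin n) ℂ)) (y : Fin n → CtBar) (d : ℕ) :
    Submodule CtBar (Fin n → CtBar) :=
  Submodule.span CtBar {w | ∃ Q ∈ invariantForms G d, (∃ a b : ℂ, MvPolynomial.aeval y Q =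
    algebraMap ℂ CtBar a + algebraMap ℂ CtBar b * tBar) ∧ w = gradAt y Q}

/-- Multiplying by a power of `B` raises the degree, keeps the value at `y`, and changes the
gradient only by a multiple of that of `B`, which lies in the larger span too. -/
theorem gradSpan_le_mul {G : Subgroup (GL (Fin n) ℂ)} {y : Fin n → CtBar} {Λ : ℕ}
    {B : MvPolynomial (Fin n) ℂ} (hB : B ∈ invariantForms G Λ)
    (hBy : MvPolynomial.aeval y B = 1) {k l : ℕ} (hk : 0 < k) (hl : 0 < l) :
    gradSpan G y (Λ * k) ≤ gradSpan G y (Λ * (k * l)) := by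
  have hgB : gradAt y B ∈ gradSpan G y (Λ * (k * l)) := by
    have h1 : gradAt y (B ^ (k * l)) ∈ gradSpan G y (Λ * (k * l)) :=
      Submodule.subset_span ⟨_, pow_mem_invariantForms hB _, ⟨1, 0, by simp [hBy]⟩, rfl⟩
    rw [gradAt_pow_of_aeval_eq_one hBy] at h1
    exact (Submodule.smul_mem_iff _ (Nat.cast_ne_zero.2 (Nat.mul_pos hk hl).ne')).1 h1
  refine Submodule.span_le.2 ?_
  rintro _ ⟨Q, hQ, hQy, rfl⟩
  obtain ⟨l, rfl⟩ : ∃ m, l = m + 1 := ⟨l - 1, by omega⟩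
  have h2 : gradAt y (Q * B ^ (k * l)) ∈ gradSpan G y (Λ * (k * (l + 1))) := by
    refine Submodule.subset_span ⟨_, ?_, ?_, rfl⟩
    · have := mul_mem_invariantForms hQ (pow_mem_invariantForms hB (k * l))
      rwa [show Λ * k + Λ * (k * l) = Λ * (k * (l + 1)) by ring] at this
    · simpa [hBy] using hQy
  rw [gradAt_mul, gradAt_pow_of_aeval_eq_one hBy, map_pow, hBy, one_pow, one_smul] at h2
  exact (Submodule.add_mem_iff_right _ (Submodule.smul_mem _ _ (Submodule.smul_mem _ _ hgB))).1 h2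

/-- In some degree, there are invariant forms with affine values and independent gradients. -/
theorem exists_forms_det_jacobian_ne_zero {G : Subgroup (GL (Fin n) ℂ)} [Finite G]
    {y : Fin n → CtBar} (hy : LinearIndependent ℂ y)
    (hval : ∀ Q ∈ invariants G, ∃ r : Ct, algebraMap Ct CtBar r = MvPolynomial.aeval y Q)
    {Λ : ℕ} (hΛ : 0 < Λ) {A B : MvPolynomial (Fin n) ℂ} (hA : A ∈ invariantForms G Λ)
    (hB : B ∈ invariantForms G Λ) (hAy : MvPolynomial.aeval y A = tBar)
    (hBy : MvPolynomial.aeval y B = 1) :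
    ∃ (k : ℕ) (P : Fin n → MvPolynomial (Fin n) ℂ), 0 < k ∧
      (∀ i, P i ∈ invariantForms G (Λ * k)) ∧
      (∀ i, ∃ a b : ℂ, MvPolynomial.aeval y (P i) =
        algebraMap ℂ CtBar a + algebraMap ℂ CtBar b * tBar) ∧
      ((jacobian P).map (MvPolynomial.aeval y)).det ≠ 0 := by
  -- Choose a degree with maximal gradient span; the span is then the same in all multiples of that
  -- degree.
  obtain ⟨_, ⟨k, hk, rfl⟩, hmax⟩ :=
    (wellFounded_gt (α := Submodule CtBar (Fin n → CtBar))).has_min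
      {V | ∃ k, 0 < k ∧ V = gradSpan G y (Λ * k)} ⟨_, 1, one_pos, rfl⟩
  have heq (l : ℕ) (hl : 0 < l) : gradSpan G y (Λ * (k * l)) = gradSpan G y (Λ * k) := by
    refine ((gradSpan_le_mul hB hBy hk hl).eq_of_not_lt ?_).symm
    exact hmax _ ⟨_, Nat.mul_pos hk hl, rfl⟩
  have htop : gradSpan G y (Λ * k) = ⊤ := by
    by_contra hne
    -- A functional that vanishes on a proper span, composed with the gradient, is a derivation at
    -- `y` killing every affine-valued form.
    obtain ⟨φ, hφ0, hφ⟩ := Submodule.exists_le_ker_of_lt_top _ (lt_top_iff_ne_top.2 hne)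
    let D : MvPolynomial (Fin n) ℂ →ₗ[ℂ] CtBar := φ.restrictScalars ℂ ∘ₗ gradAt y
    have hDdef (Q : MvPolynomial (Fin n) ℂ) : D Q = φ (gradAt y Q) := rfl
    have hD (P Q : MvPolynomial (Fin n) ℂ) :
        D (P * Q) = MvPolynomial.aeval y P * D Q + MvPolynomial.aeval y Q * D P := by
      simp only [hDdef, gradAt_mul, map_add, map_smul, smul_eq_mul]
    have hkill (l : ℕ) (hl : 0 < l) (Q : MvPolynomial (Fin n) ℂ)
        (hQ : Q ∈ invariantForms G (Λ * k * l)) (hQy : ∃ a b : ℂ, MvPolynomial.aeval y Q =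
          algebraMap ℂ CtBar a + algebraMap ℂ CtBar b * tBar) : D Q = 0 := by
      rw [mul_assoc] at hQ
      have : gradAt y Q ∈ gradSpan G y (Λ * k) := heq l hl ▸ Submodule.subset_span ⟨Q, hQ, hQy, rfl⟩
      exact hφ this
    have hB' : B ^ k ∈ invariantForms G (Λ * k) := pow_mem_invariantForms hB k
    have hA' : A * B ^ (k - 1) ∈ invariantForms G (Λ * k) := by
      have := mul_mem_invariantForms hA (pow_mem_invariantForms hB (k - 1))
      rwa [show Λ + Λ * (k - 1) = Λ * k by
        obtain ⟨m, rfl⟩ : ∃ m, k = m + 1 := ⟨k - 1, by omega⟩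
        simp only [Nat.add_sub_cancel]; ring] at this
    have hX := pointDerivation_X_eq_zero hy hD (Nat.mul_pos hΛ hk) fun l hl Q hQ =>
      pointDerivation_invariantForms_eq_zero hD hval hA' hB' (by simp [hAy, hBy]) (by simp [hBy])
        hkill hl hQ
    apply hφ0
    refine LinearMap.pi_ext' fun j => LinearMap.ext_ring ?_
    have hgX : gradAt y (MvPolynomial.X j) = Pi.single j 1 := by
      ext i
      by_cases h : i = j
      · subst h; simp [gradAt]
      · simp [gradAt, h, MvPolynomial.pderiv_X_of_ne (Ne.symm h)]
    simpa [hDdef, hgX] using hX j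
  have hrank : Module.finrank CtBar (Submodule.span CtBar {w | ∃ Q ∈ invariantForms G (Λ * k),
      (∃ a b : ℂ, MvPolynomial.aeval y Q = algebraMap ℂ CtBar a + algebraMap ℂ CtBar b * tBar) ∧
      w = gradAt y Q}) = n := by
    change Module.finrank CtBar (gradSpan G y (Λ * k)) = n
    rw [htop, finrank_top, Module.finrank_fin_fun]
  -- A basis of the full space can be chosen among the spanning gradients themselves; they become
  -- the rows of the Jacobian.
  obtain ⟨w, hw, -, hli⟩ := Submodule.exists_fun_fin_finrank_span_eq CtBar
    {w | ∃ Q ∈ invariantForms G (Λ * k),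
      (∃ a b : ℂ, MvPolynomial.aeval y Q = algebraMap ℂ CtBar a + algebraMap ℂ CtBar b * tBar) ∧
      w = gradAt y Q}
  choose P hP hPy hPw using fun i : Fin n => hw (Fin.cast hrank.symm i)
  refine ⟨k, P, hk, hP, hPy, ?_⟩
  have hrows : LinearIndependent CtBar ((jacobian P).map (MvPolynomial.aeval y)).row := by
    have h1 : ((jacobian P).map (MvPolynomial.aeval y)).row = fun i => w (Fin.cast hrank.symm i) := by
      funext i
      rw [hPw]
      rfl
    rw [h1]
    exact hli.comp _ (Fin.cast_injective _)
  rw [Matrix.linearIndependent_rows_iff_isUnit, Matrix.isUnit_iff_isUnit_det] at hrows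
  exact hrows.ne_zero

/-! ### Conjugation of differential operators -/

/-- The differential operators of order less than `k` over `ℂ(t)`. -/
def opsLT (k : ℕ) : Submodule Ct (CtBar → CtBar) :=
  Submodule.span Ct (Set.range fun i : Fin k => (ddt CtBar)^[i])

theorem iterate_mem_opsLT {i k : ℕ} (h : i < k) : (ddt CtBar)^[i] ∈ opsLT k :=
  Submodule.subset_span ⟨⟨i, h⟩, rfl⟩

theorem opsLT_mono {k l : ℕ} (h : k ≤ l) : opsLT k ≤ opsLT l :=
  Submodule.span_le.2 <| by
    rintro _ ⟨i, rfl⟩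
    exact iterate_mem_opsLT (i.2.trans_le h)

theorem ddt_comp_mem_opsLT {k : ℕ} {T : CtBar → CtBar} (hT : T ∈ opsLT k) :
    (fun u => ddt CtBar (T u)) ∈ opsLT (k + 1) := by
  induction hT using Submodule.span_induction with
  | mem T h =>
    obtain ⟨i, rfl⟩ := h
    simp only [← Function.iterate_succ_apply' (ddt CtBar)]
    exact iterate_mem_opsLT (Nat.succ_lt_succ i.2)
  | zero =>
    simp only [Pi.zero_apply, map_zero]
    exact Submodule.zero_mem _
  | add S T _ _ hS hT =>
    simp only [Pi.add_apply, map_add]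
    exact Submodule.add_mem _ hS hT
  | smul a T hT' hT =>
    have h : (fun u => ddt CtBar ((a • T) u)) =
        a • (fun u => ddt CtBar (T u)) + ddt Ct a • T := by
      funext u
      simp only [Pi.add_apply, Pi.smul_apply]
      simp only [Algebra.smul_def, Derivation.leibniz, ddt_alg_algebraMap,
        Algebra.algebraMap_self, RingHom.id_apply]
      ring
    rw [h]
    exact Submodule.add_mem _ (Submodule.smul_mem _ _ hT)
      (Submodule.smul_mem _ _ (opsLT_mono k.le_succ hT'))

/-- Conjugation by `f` turns `d/dt` into `d/dt + r`, so the leading term is unchanged and the rest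
has coefficients in `ℂ(t)`. -/
theorem exists_conj_iterate {f : CtBar} (hf : f ≠ 0) {r : Ct}
    (hr : f⁻¹ * ddt CtBar f = algebraMap Ct CtBar r) (k : ℕ) :
    ∃ T ∈ opsLT k, ∀ u, f⁻¹ * (ddt CtBar)^[k] (f * u) = (ddt CtBar)^[k] u + T u := by
  induction k with
  | zero => exact ⟨0, Submodule.zero_mem _, fun u => by simp [hf]⟩
  | succ k ih =>
    obtain ⟨T, hT, h⟩ := ih
    refine ⟨(fun u => ddt CtBar (T u)) + r • ((ddt CtBar)^[k] + T),
      Submodule.add_mem _ (ddt_comp_mem_opsLT hT) (Submodule.smul_mem _ _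
        (Submodule.add_mem _ (iterate_mem_opsLT k.lt_succ_self) (opsLT_mono k.le_succ hT))),
      fun u => ?_⟩
    have h1 : (ddt CtBar)^[k] (f * u) = f * ((ddt CtBar)^[k] u + T u) := by
      rw [← h]; field_simp
    rw [Function.iterate_succ_apply', h1, Derivation.leibniz, map_add,
      ← Function.iterate_succ_apply' (ddt CtBar)]
    simp only [Pi.add_apply, Pi.smul_apply, smul_eq_mul]
    rw [Algebra.smul_def, ← hr]
    field_simp
    ring

theorem conj_mem_opsLT {f : CtBar} (hf : f ≠ 0) {r : Ct}
    (hr : f⁻¹ * ddt CtBar f = algebraMap Ct CtBar r) {k : ℕ} {T : CtBar → CtBar}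
    (hT : T ∈ opsLT k) : (fun u => f⁻¹ * T (f * u)) ∈ opsLT k := by
  induction hT using Submodule.span_induction with
  | mem T h =>
    obtain ⟨i, rfl⟩ := h
    obtain ⟨S, hS, h⟩ := exists_conj_iterate hf hr i
    simp only [h]
    exact Submodule.add_mem _ (iterate_mem_opsLT i.2) (opsLT_mono i.2.le hS)
  | zero =>
    simp only [Pi.zero_apply, mul_zero]
    exact Submodule.zero_mem _
  | add S T _ _ hS hT =>
    simp only [Pi.add_apply, mul_add]
    exact Submodule.add_mem _ hS hT
  | smul a T _ hT =>
    simp only [Pi.smul_apply, mul_smul_comm]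
    exact Submodule.smul_mem _ a hT

namespace LinODE

theorem exists_conj {f : CtBar} (hf : f ≠ 0) {r : Ct}
    (hr : f⁻¹ * ddt CtBar f = algebraMap Ct CtBar r) (L : LinODE n) :
    ∃ M : LinODE n, ∀ u, M.app u = f⁻¹ * L.app (f * u) := by
  obtain ⟨T, hT, h⟩ := exists_conj_iterate hf hr n
  have hS : (∑ i : Fin n, L.coeff i • (ddt CtBar)^[i]) ∈ opsLT n :=
    Submodule.sum_mem _ fun i _ => Submodule.smul_mem _ _ (iterate_mem_opsLT i.2)
  obtain ⟨c, hc⟩ := (Submodule.mem_span_range_iff_exists_fun Ct).1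
    (Submodule.add_mem _ hT (conj_mem_opsLT hf hr hS))
  refine ⟨⟨c⟩, fun u => ?_⟩
  have h1 := congrFun hc u
  simp only [Finset.sum_apply, Pi.add_apply, Pi.smul_apply] at h1
  simp only [Algebra.smul_def] at h1
  rw [app, app, mul_add, h, h1, add_assoc]

theorem logDeriv_inv {f : CtBar} (hf : f ≠ 0) {r : Ct}
    (hr : f⁻¹ * ddt CtBar f = algebraMap Ct CtBar r) :
    f⁻¹⁻¹ * ddt CtBar f⁻¹ = algebraMap Ct CtBar (-r) := by
  rw [Derivation.leibniz_inv, map_neg, ← hr, smul_eq_mul]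
  field_simp

/-- A factorization of the conjugate operator is carried back, factor by factor, by conjugating with
`f⁻¹`. -/
theorem IsIrreducible.of_conj {f : CtBar} (hf : f ≠ 0) {r : Ct}
    (hr : f⁻¹ * ddt CtBar f = algebraMap Ct CtBar r) {L M : LinODE n} (hL : L.IsIrreducible)
    (hM : ∀ u, M.app u = f⁻¹ * L.app (f * u)) : M.IsIrreducible := by
  refine ⟨hL.1, fun p q A B hp hq hAB => ?_⟩
  obtain ⟨A', hA'⟩ := exists_conj (inv_ne_zero hf) (logDeriv_inv hf hr) A
  obtain ⟨B', hB'⟩ := exists_conj (inv_ne_zero hf) (logDeriv_inv hf hr) B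
  refine hL.2 p q A' B' hp hq fun u => ?_
  rw [hA', hB', inv_inv, inv_mul_cancel_left₀ hf, ← hAB, hM, mul_inv_cancel_left₀ hf,
    mul_inv_cancel_left₀ hf]

end LinODE

theorem linearIndependent_const_mul {x : Fin n → CtBar} (hx : LinearIndependent ℂ x) {f : CtBar}
    (hf : f ≠ 0) : LinearIndependent ℂ fun j => f * x j :=
  hx.map' (LinearMap.mulLeft ℂ f) (LinearMap.ker_eq_bot.2 (mul_right_injective₀ hf))

theorem ddt_tBar : ddt CtBar tBar = 1 := by
  have h : (RatFunc.X : Ct) = algebraMap ℂ[X] Ct X := (RatFunc.algebraMap_X).symm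
  rw [tBar, h, ddt_alg_algebraMap, ddt_algebraMap, derivative_X, map_one, map_one]

theorem tBar_ne_const (c : ℂ) : tBar ≠ algebraMap ℂ CtBar c := fun h => by
  have := congrArg (ddt CtBar) h
  rw [ddt_tBar, Derivation.map_algebraMap] at this
  exact one_ne_zero this

theorem ddt_ratFunc_X : ddt Ct (RatFunc.X : Ct) = 1 := by
  have h : (RatFunc.X : Ct) = algebraMap ℂ[X] Ct X := (RatFunc.algebraMap_X).symm
  rw [h, ddt_algebraMap, derivative_X, map_one]

/-! ### Standard equations have associated dynamical systems -/

/-- If the values of the forms are affine functions of `t`, then the associated equation is a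
dynamical system. -/
theorem isDynamicalSystem_of_affine (P : Fin n → MvPolynomial (Fin n) ℂ) (a b : Fin n → ℂ) :
    IsDynamicalSystem P fun i => algebraMap ℂ Ct (a i) + algebraMap ℂ Ct (b i) * RatFunc.X := by
  intro v _ i
  refine ⟨∑ j, ((jacobian P).map (MvPolynomial.eval v))⁻¹ i j * b j, ?_⟩
  simp only [associatedField, Matrix.mulVec, dotProduct, Matrix.map_apply, map_add,
    Derivation.leibniz, ddt_ratFunc_X, Derivation.map_algebraMap, smul_eq_mul, mul_one, mul_zero,
    zero_add, add_zero, map_sum, map_mul]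

theorem LinODE.IsStandard.exists_dynamicalSystem (hn : 2 ≤ n) {L : LinODE n}
    (hirr : L.IsIrreducible) (hL : L.IsStandard) :
    ∃ L₁ : LinODE n, L.IsRatProjEquiv L₁ ∧ L₁.HasAssociatedDynamicalSystem := by
  have hn0 : 0 < n := by omega
  obtain ⟨x, hx, hmin⟩ := hL
  have hX : (RatFunc.X : Ct) ∈ quotientFanoField x := by
    rw [show quotientFanoField x = ⊤ from hmin]
    exact IntermediateField.mem_top
  obtain ⟨k, A, B, hA, hB, hB0, ht⟩ := hX
  obtain ⟨b, hb⟩ := hx.exists_algebraMap_eq_aeval hn0 (mem_invariantForms.1 hB).1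
  -- A quotient of forms of degree 0 is constant, and `t` is not.
  have hk : 0 < k := by
    refine Nat.pos_of_ne_zero ?_
    rintro rfl
    obtain ⟨c, hc⟩ : ∃ c, A = MvPolynomial.C c :=
      ⟨_, MvPolynomial.totalDegree_eq_zero_iff_eq_C.1 (Nat.le_zero.1 hA.2.totalDegree_le)⟩
    obtain ⟨d, hd⟩ : ∃ c, B = MvPolynomial.C c :=
      ⟨_, MvPolynomial.totalDegree_eq_zero_iff_eq_C.1 (Nat.le_zero.1 hB.2.totalDegree_le)⟩
    refine tBar_ne_const (c / d) (ht.trans ?_)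
    rw [hc, hd, MvPolynomial.aeval_C, MvPolynomial.aeval_C, map_div₀]
  -- This normalization makes `B` equal to 1 at `y = x / f`, hence `A` equal to `t`.
  obtain ⟨f, hfk⟩ := IsAlgClosed.exists_pow_nat_eq (MvPolynomial.aeval x B) hk
  have hf : f ≠ 0 := by
    rintro rfl
    rw [zero_pow hk.ne'] at hfk
    exact hB0 hfk.symm
  have hkK : (k : CtBar) ≠ 0 := Nat.cast_ne_zero.2 hk.ne'
  have hr : f⁻¹ * ddt CtBar f = algebraMap Ct CtBar (ddt Ct b / (k * b)) := by
    have h1 := congrArg (ddt CtBar) (hfk.trans hb.symm)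
    rw [ddt_alg_algebraMap, Derivation.leibniz_pow, smul_eq_mul, nsmul_eq_mul] at h1
    rw [map_div₀, ← h1, map_mul, hb, ← hfk, map_natCast]
    obtain ⟨m, rfl⟩ : ∃ m, k = m + 1 := ⟨k - 1, by omega⟩
    rw [Nat.add_sub_cancel, pow_succ]
    field_simp
  obtain ⟨L₁, hL₁⟩ := L.exists_conj hf hr
  set y : Fin n → CtBar := fun j => f⁻¹ * x j with hy
  have hxy (j : Fin n) : x j = f * y j := (mul_inv_cancel_left₀ hf _).symm
  have hyfull : L₁.IsFullSystem y :=
    ⟨fun j => by rw [hL₁, ← hxy, hx.1, mul_zero], linearIndependent_const_mul hx.2 (inv_ne_zero hf)⟩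
  have hσ (σ : CtBar ≃ₐ[Ct] CtBar) :
      ∃ c : ℂ, c ^ k = 1 ∧ σ f = algebraMap ℂ CtBar c * f := by
    obtain ⟨c, hck, hc⟩ := exists_root_of_unity_eq (w := σ f / f) hk (by
      rw [div_pow, ← map_pow, hfk, ← hb, σ.commutes, div_self (by rw [hb]; exact hB0)])
    exact ⟨c, hck, (div_eq_iff hf).1 hc⟩
  have hle := invariantForms_le_of_mul hf hxy hσ
  have hev {Q : MvPolynomial (Fin n) ℂ} (hQ : Q.IsHomogeneous k) :
      MvPolynomial.aeval y Q = MvPolynomial.aeval x Q / MvPolynomial.aeval x B := by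
    rw [hy, aeval_mul_of_isHomogeneous hQ, inv_pow, hfk, div_eq_inv_mul]
  have hBy : MvPolynomial.aeval y B = 1 := by rw [hev hB.2, div_self hB0]
  have hAy : MvPolynomial.aeval y A = tBar := by rw [hev hA.2, ← ht]
  have := finite_galoisRep hyfull.2
  obtain ⟨M, hM, hcoord⟩ := exists_isCoordinateDegree (galoisRep y)
  -- Passing to degree `k * M` keeps the values 1 and `t` and makes every later degree a coordinate
  -- degree.
  have hB' : B ^ M ∈ invariantForms (galoisRep y) (k * M) := pow_mem_invariantForms (hle hB) M
  have hA' : A * B ^ (M - 1) ∈ invariantForms (galoisRep y) (k * M) := by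
    obtain ⟨m, rfl⟩ : ∃ m, M = m + 1 := ⟨M - 1, by omega⟩
    have := mul_mem_invariantForms (hle hA) (pow_mem_invariantForms (hle hB) m)
    rwa [show k + k * m = k * (m + 1) by ring] at this
  obtain ⟨l, P, hl, hP, hPy, hdet⟩ := exists_forms_det_jacobian_ne_zero hyfull.2
    (fun Q hQ => hyfull.exists_algebraMap_eq_aeval hn0 (mem_invariants.1 hQ))
    (Nat.mul_pos hk hM) hA' hB' (by simp [hAy, hBy]) (by simp [hBy])
  choose α β hαβ using hPy
  refine ⟨L₁, ⟨f, hf, ⟨_, hr⟩, fun z hz => ⟨f⁻¹ * z, ?_, (mul_inv_cancel_left₀ hf z).symm⟩⟩,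
    ⟨y, hyfull⟩, hirr.of_conj hf hr hL₁, y, k * M * l, P, _,
    ⟨hyfull, hcoord _ (Nat.mul_pos (Nat.mul_pos hk hM) hl) ⟨k * l, by ring⟩, hP, hdet,
      fun i => ?_⟩, isDynamicalSystem_of_affine P α β⟩
  · rw [hL₁, mul_inv_cancel_left₀ hf, hz, mul_zero]
  · rw [hαβ, map_add, map_mul, ← IsScalarTower.algebraMap_apply, ← IsScalarTower.algebraMap_apply]

/-! ### Equations with associated dynamical systems are standard -/

theorem ddt_aeval (y : Fin n → CtBar) (Q : MvPolynomial (Fin n) ℂ) :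
    ddt CtBar (MvPolynomial.aeval y Q) =
      ∑ j, MvPolynomial.aeval y (MvPolynomial.pderiv j Q) * ddt CtBar (y j) := by
  induction Q using MvPolynomial.induction_on with
  | C c => simp
  | add P Q hP hQ => simp only [map_add, hP, hQ, add_mul, Finset.sum_add_distrib]
  | mul_X P i hP =>
    simp only [map_mul, Derivation.leibniz, MvPolynomial.aeval_X, hP, smul_eq_mul, map_add,
      add_mul, Finset.sum_add_distrib, Finset.mul_sum]
    congr 1
    · rw [Finset.sum_eq_single i (fun j _ hj => by
        rw [MvPolynomial.pderiv_X_of_ne (Ne.symm hj)]; simp) (by simp)]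
      simp
    · exact Finset.sum_congr rfl fun j _ => by ring

/-- The values of the forms of an associated dynamical system are affine functions of `t`. -/
theorem IsDynamicalSystem.exists_affine {P : Fin n → MvPolynomial (Fin n) ℂ} {F : Fin n → Ct}
    (h : IsDynamicalSystem P F) {y : Fin n → CtBar}
    (hdet : ((jacobian P).map (MvPolynomial.aeval y)).det ≠ 0) (i : Fin n) :
    ∃ a b : ℂ, algebraMap Ct CtBar (F i) =
      algebraMap ℂ CtBar a + algebraMap ℂ CtBar b * tBar := by
  have hne : (jacobian P).det ≠ 0 := by
    intro h0
    apply hdet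
    have := (MvPolynomial.aeval (R := ℂ) y).map_det (jacobian P)
    rw [h0, map_zero] at this
    exact this.symm
  -- One complex point `v` with invertible `M(v)` suffices: there `f' = M(v) F(t, v)` with both
  -- factors constant in `t`.
  obtain ⟨v, hv⟩ : ∃ v, MvPolynomial.eval v (jacobian P).det ≠ 0 := by
    by_contra! h0
    exact hne (MvPolynomial.funext fun v => by rw [h0, map_zero])
  have hv' : ((jacobian P).map (MvPolynomial.eval v)).det ≠ 0 := by
    rwa [RingHom.map_det] at hv
  choose c hc using h v hv'
  set M := (jacobian P).map (MvPolynomial.eval v) with hM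
  have hmul : (fun i => ddt Ct (F i)) = (M.map (algebraMap ℂ Ct)).mulVec (associatedField P F v) := by
    rw [associatedField, Matrix.mulVec_mulVec, ← Matrix.map_mul,
      Matrix.mul_nonsing_inv _ (isUnit_iff_ne_zero.2 hv')]
    simp
  have hd : ddt Ct (F i) = algebraMap ℂ Ct (∑ j, M i j * c j) := by
    rw [show ddt Ct (F i) = _ from congrFun hmul i]
    simp [Matrix.mulVec, dotProduct, hc]
  obtain ⟨a, ha⟩ := exists_eq_algebraMap_of_ddt_eq_zero
    (u := F i - algebraMap ℂ Ct (∑ j, M i j * c j) * RatFunc.X) (by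
      rw [map_sub, Derivation.leibniz, ddt_ratFunc_X, Derivation.map_algebraMap, hd]
      simp)
  refine ⟨a, ∑ j, M i j * c j, ?_⟩
  rw [sub_eq_iff_eq_add.1 ha, map_add, map_mul, ← IsScalarTower.algebraMap_apply,
    ← IsScalarTower.algebraMap_apply]

/-- Some two of the affine values of the forms are not proportional. -/
theorem exists_not_proportional (hn : 2 ≤ n) {y : Fin n → CtBar} (hy : LinearIndependent ℂ y)
    {P : Fin n → MvPolynomial (Fin n) ℂ} {Λ : ℕ} (hΛ : 0 < Λ) (hP : ∀ i, (P i).IsHomogeneous Λ)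
    (hdet : ((jacobian P).map (MvPolynomial.aeval y)).det ≠ 0) {a b : Fin n → ℂ}
    (hab : ∀ i, MvPolynomial.aeval y (P i) =
      algebraMap ℂ CtBar (a i) + algebraMap ℂ CtBar (b i) * tBar) :
    ∃ i j, a i * b j - a j * b i ≠ 0 := by
  by_contra! h
  set M := (jacobian P).map (MvPolynomial.aeval y) with hM
  have hMij (i j : Fin n) : M i j = MvPolynomial.aeval y (MvPolynomial.pderiv j (P i)) := rfl
  have hker (w : Fin n → CtBar) (hw : ∀ i, ∑ j, M i j * w j = 0) : w = 0 :=
    Matrix.eq_zero_of_mulVec_eq_zero hdet (funext hw)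
  -- Euler's relation gives `M y = Λ P(y)`, the chain rule below gives `M y' = b`.
  have heuler (i : Fin n) : ∑ j, M i j * y j = Λ * MvPolynomial.aeval y (P i) := by
    have := congrArg (MvPolynomial.aeval y) (hP i).sum_X_mul_pderiv
    simpa [hMij, mul_comm] using this
  have hder (i : Fin n) : ∑ j, M i j * ddt CtBar (y j) = algebraMap ℂ CtBar (b i) := by
    have h1 := ddt_aeval y (P i)
    rw [hab, map_add, Derivation.map_algebraMap, Derivation.leibniz, Derivation.map_algebraMap,
      ddt_tBar] at h1
    rw [zero_add, smul_zero, add_zero, smul_eq_mul, mul_one] at h1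
    exact h1.symm
  obtain ⟨j, hj⟩ : ∃ j, MvPolynomial.aeval y (P j) ≠ 0 := by
    by_contra! h0
    refine hy.ne_zero (⟨0, by omega⟩ : Fin n) (congrFun (hker y fun i => ?_) _)
    rw [heuler, h0, mul_zero]
  -- Proportionality puts `Λ P_j(y) y' - b_j y` in the kernel of `M`. So all `y_l` have the same
  -- logarithmic derivative and constant ratios.
  have hw := hker (fun l => Λ * MvPolynomial.aeval y (P j) * ddt CtBar (y l) -
    algebraMap ℂ CtBar (b j) * y l) fun i => by
      have e : ∑ l, M i l * (Λ * MvPolynomial.aeval y (P j) * ddt CtBar (y l) -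
          algebraMap ℂ CtBar (b j) * y l) = Λ * MvPolynomial.aeval y (P j) *
          (∑ l, M i l * ddt CtBar (y l)) - algebraMap ℂ CtBar (b j) * ∑ l, M i l * y l := by
        rw [Finset.mul_sum, Finset.mul_sum, ← Finset.sum_sub_distrib]
        exact Finset.sum_congr rfl fun l _ => by ring
      have h1 := congrArg (algebraMap ℂ CtBar) (h i j)
      simp only [map_sub, map_mul, map_zero] at h1
      rw [e, hder, heuler, hab, hab]
      linear_combination (-(Λ : CtBar)) * h1
  have hs : (Λ : CtBar) * MvPolynomial.aeval y (P j) ≠ 0 :=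
    mul_ne_zero (Nat.cast_ne_zero.2 hΛ.ne') hj
  have hdy (l : Fin n) : ddt CtBar (y l) =
      algebraMap ℂ CtBar (b j) / (Λ * MvPolynomial.aeval y (P j)) * y l := by
    have := sub_eq_zero.1 (congrFun hw l)
    rw [div_mul_eq_mul_div, eq_div_iff hs, ← this, mul_comm]
  let p : Fin n := ⟨0, by omega⟩
  let q : Fin n := ⟨1, by omega⟩
  have hpq : p ≠ q := by simp [p, q]
  obtain ⟨c, hc⟩ := exists_eq_algebraMap_of_ddt_alg_eq_zero (u := y p / y q) (by
    rw [Derivation.leibniz_div, hdy p, hdy q, smul_eq_mul, smul_eq_mul, smul_eq_mul]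
    ring)
  rw [div_eq_iff (hy.ne_zero q)] at hc
  have := coeff_eq_of_sum_eq hy (a := Pi.single p 1) (b := Pi.single q c) (by
    rw [Finset.sum_eq_single p (fun l _ hl => by simp [hl]) (by simp),
      Finset.sum_eq_single q (fun l _ hl => by simp [hl]) (by simp)]
    simp [hc, mul_comm])
  simpa [hpq] using congrFun this p

theorem LinODE.IsStandard.of_dynamicalSystem (hn : 2 ≤ n) {L L₁ : LinODE n}
    (halg : L.IsAlgebraic) (hequiv : L.IsRatProjEquiv L₁)
    (hL₁ : L₁.HasAssociatedDynamicalSystem) : L.IsStandard := by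
  have hn0 : 0 < n := by omega
  obtain ⟨f, hf, ⟨r, hr⟩, hsol⟩ := hequiv
  obtain ⟨-, -, y, Λ, P, F, hdata, hdyn⟩ := hL₁
  obtain ⟨z, hz⟩ := halg
  have hΛ : 0 < Λ := hdata.coordinateDegree.1
  -- The equivalence only divides solutions of `L` by `f`. Since `L` has `n` independent ones, the
  -- quotients span the solutions of `L₁`, so each `f y_j` solves `L`.
  have hzfull : L₁.IsFullSystem fun j => f⁻¹ * z j := by
    refine ⟨fun j => ?_, linearIndependent_const_mul hz.2 (inv_ne_zero hf)⟩
    obtain ⟨w, hw, hzw⟩ := hsol (z j) (hz.1 j)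
    simp only [hzw, inv_mul_cancel_left₀ hf, hw]
  set x : Fin n → CtBar := fun j => f * y j with hx
  have hxfull : L.IsFullSystem x := by
    refine ⟨fun j => ?_, linearIndependent_const_mul hdata.fullSystem.2 hf⟩
    obtain ⟨c, hc⟩ := hzfull.exists_eq_sum hn0 (hdata.fullSystem.1 j)
    have : x j = ∑ l, z l * algebraMap ℂ CtBar (c l) := by
      simp only [hx, hc, Finset.mul_sum, ← mul_assoc, mul_inv_cancel₀ hf, one_mul]
    rw [this, L.app_sum]
    simp [hz.1]
  refine ⟨x, hxfull, ?_⟩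
  choose a b hab using hdyn.exists_affine hdata.det_jacobian_ne_zero
  simp only [hdata.eval_eq] at hab
  obtain ⟨i, j, hδ⟩ := exists_not_proportional hn hdata.fullSystem.2 hΛ
    (fun i => (hdata.mem_invariantForms i).2) hdata.det_jacobian_ne_zero hab
  -- Cramer's rule: the values of `A` and `B` at `y` are `δ t` and `δ`, with `δ = a_i b_j - a_j
  -- b_i`.
  set A := a i • P j - a j • P i with hAdef
  set B := b j • P i - b i • P j with hBdef
  have hA : A ∈ invariantForms (galoisRep y) Λ := Submodule.sub_mem _
    (Submodule.smul_mem _ _ (hdata.mem_invariantForms j))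
    (Submodule.smul_mem _ _ (hdata.mem_invariantForms i))
  have hB : B ∈ invariantForms (galoisRep y) Λ := Submodule.sub_mem _
    (Submodule.smul_mem _ _ (hdata.mem_invariantForms i))
    (Submodule.smul_mem _ _ (hdata.mem_invariantForms j))
  have hBy : MvPolynomial.aeval y B = algebraMap ℂ CtBar (a i * b j - a j * b i) := by
    rw [hBdef, map_sub, map_smul, map_smul, hab, hab, Algebra.smul_def, Algebra.smul_def]
    simp only [map_sub, map_mul]
    ring
  have hAy : MvPolynomial.aeval y A = algebraMap ℂ CtBar (a i * b j - a j * b i) * tBar := by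
    rw [hAdef, map_sub, map_smul, map_smul, hab, hab, Algebra.smul_def, Algebra.smul_def]
    simp only [map_sub, map_mul]
    ring
  have hδ' : algebraMap ℂ CtBar (a i * b j - a j * b i) ≠ 0 :=
    (map_ne_zero (algebraMap ℂ CtBar)).2 hδ
  obtain ⟨N, hN, hσ⟩ := exists_pow_eq_one_of_logDeriv hf hr
  -- In degrees divisible by `N` the roots of unity by which the Galois group multiplies `f` act
  -- trivially. `A` and `B` are then both multiplied by `B^(N-1)`, which preserves their quotient.
  have hle : invariantForms (galoisRep y) (Λ * N) ≤ invariantForms (galoisRep x) (Λ * N) := by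
    refine invariantForms_le_of_mul (f := f⁻¹) (inv_ne_zero hf)
      (fun j => (inv_mul_cancel_left₀ hf _).symm) fun σ => ?_
    obtain ⟨c, hcN, hc⟩ := hσ σ
    refine ⟨c⁻¹, ?_, ?_⟩
    · rw [inv_pow, mul_comm, pow_mul, hcN, one_pow, inv_one]
    · rw [map_inv₀, hc, mul_inv, map_inv₀]
  have hB' : B ^ N ∈ invariantForms (galoisRep y) (Λ * N) := pow_mem_invariantForms hB N
  have hA' : A * B ^ (N - 1) ∈ invariantForms (galoisRep y) (Λ * N) := by
    obtain ⟨m, rfl⟩ : ∃ m, N = m + 1 := ⟨N - 1, by omega⟩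
    have := mul_mem_invariantForms hA (pow_mem_invariantForms hB m)
    rwa [show Λ + Λ * m = Λ * (m + 1) by ring] at this
  have hmem : (RatFunc.X : Ct) ∈ quotientFanoField x := by
    have hd : f ^ (Λ * N) ≠ 0 := pow_ne_zero _ hf
    refine ⟨Λ * N, A * B ^ (N - 1), B ^ N, hle hA', hle hB', ?_, ?_⟩
    · rw [hx, aeval_mul_of_isHomogeneous hB'.2, map_pow, hBy]
      exact mul_ne_zero hd (pow_ne_zero _ hδ')
    · rw [hx, aeval_mul_of_isHomogeneous hB'.2, aeval_mul_of_isHomogeneous hA'.2,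
        mul_div_mul_left _ _ hd, map_mul, map_pow, map_pow, hAy, hBy]
      obtain ⟨m, rfl⟩ : ∃ m, N = m + 1 := ⟨N - 1, by omega⟩
      rw [Nat.add_sub_cancel, pow_succ']
      field_simp
  rw [IsMinimalSchwarzMap, eq_top_iff, ← RatFunc.adjoin_X, IntermediateField.adjoin_le_iff]
  exact Set.singleton_subset_iff.2 hmem

end SchwarzODE

end

theorem theorem1p6 (n : ℕ) (hn : 2 ≤ n) (L : SchwarzODE.LinODE n)
    (halg : L.IsAlgebraic) (hirr : L.IsIrreducible) :
    L.IsStandard ↔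
      ∃ L₁ : SchwarzODE.LinODE n, L.IsRatProjEquiv L₁ ∧ L₁.HasAssociatedDynamicalSystem :=
  ⟨fun h => h.exists_dynamicalSystem hn hirr,
    fun ⟨_, hequiv, hL₁⟩ => .of_dynamicalSystem hn halg hequiv hL₁⟩
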